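/- Let $G$ be a finite non-abelian group, let $G'$ be its commutator subgroup and $G^{ab}=G/G'$ its abelianization, and let $M(G)=H_2(G,\mathbb{Z})$ be its Schur multiplier. Write $\mathbb{Z}_n$ for the cyclic group of order $n$, and let $p<q<r$ denote primes. (i) If $|G|$ is square-free, then $M(G)=0$. (ii) If $|G|=p^2q$ with $p<q$, then one of the following three cases occurs, and $$M(G)\cong\begin{cases}0 & \text{if } G'\cong\mathbb{Z}_q \text{ and } G^{ab}\cong\mathbb{Z}_{p^2},\\ \mathbb{Z}_p & \text{if } G'\cong\mathbb{Z}_q \text{ and } G^{ab}\cong\mathbb{Z}_p\times\mathbb{Z}_p,\\ \mathbb{Z}_2 & \text{if } G'\cong\mathbb{Z}_2\times\mathbb{Z}_2.\end{cases}$$ (iii) If $|G|=pq^2$ with $p<q$, then one of the following three cases occurs, and $$M(G)\cong\begin{cases}0 & \text{if } G'\cong\mathbb{Z}_q,\\ 0 & \text{if } G'\cong\mathbb{Z}_{q^2},\\ 0 \text{ or } \mathbb{Z}_q & \text{if } G'\cong\mathbb{Z}_q\times\mathbb{Z}_q.\end{cases}$$ (iv) If $|G|=p^2qr$ with $p<q<r$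 and $pq\neq 6$, then $M(G)=0$ if $G^{ab}$ is cyclic, and $M(G)\cong\mathbb{Z}_p$ otherwise. (v) If $|G|=p^2qr$ with $p<q<r$ and $pq=6$ (so $|G|=12r$), then $M(G)\cong\mathbb{Z}_2$ if $|G'|=4$ or $|G'|=4r$. If $|G'|\neq 4$, $|G'|\neq 4r$ and $G$ is not perfect (that is, $G'\neq G$, which only excludes $G\cong A_5$), then $M(G)=0$ if $G^{ab}$ is cyclic, and $M(G)\cong\mathbb{Z}_p$ otherwise. -/

import Mathlib

/-- The Schur multiplier `M(G)` of a group `G`: the second integral homology group `H₂(G, ℤ)`,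
where `G` acts trivially on `ℤ`. It is an abelian group, written additively. -/
noncomputable abbrev schurMultiplier (G : Type) [Group G] : ModuleCat ℤ :=
  groupHomology.H2 (Rep.trivial ℤ G ℤ)

/-- The (multiplicative) group `H` is isomorphic to the additively written group `A`. -/
abbrev IsoAdd (H A : Type*) [Group H] [AddGroup A] : Prop :=
  Nonempty (H ≃* Multiplicative A)

/-- `M(G)` is isomorphic to the cyclic group `ℤ/n`. -/
abbrev SchurIsZMod (G : Type) [Group G] (n : ℕ) : Prop :=
  Nonempty (schurMultiplier G ≃+ ZMod n)

/-- `M(G) = 0`. -/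
abbrev SchurIsZero (G : Type) [Group G] : Prop :=
  Subsingleton (schurMultiplier G)

/-! Since ℚ/ℤ is injective, characters of `M(G)` come from 2-cocycles with values in ℚ/ℤ, that is,
from central extensions of `G` by ℚ/ℤ, and characters separate points. So `M(G) = 0` once every such
cocycle is a coboundary. If the preimage in the extension of a subgroup `H` of finite index is
abelian, injectivity gives a retraction of this preimage onto ℚ/ℤ, and its transfer shows that
`H.index` annihilates the class (`kills_index_of_comm`). Cyclic subgroups always have abelian
preimage, so a group with all Sylow subgroups cyclic has trivial multiplier; this settles
square-free order.

In the other cases a single Sylow subgroup `P`, of order `p²`, can be noncyclic. If `P` is generated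
by `x, y`, its preimage is abelian exactly when `f x y = f y x`. Hence `M(G)` is generated by the
class of `[x|y] - [y|x]`, which is annihilated by `p`, and is 0 or `ℤ/p` (`schur_of_sylow`). What
remains is to decide whether some cocycle separates `(x, y)` from `(y, x)`.

When `p` is the smallest prime divisor there are two cases. Either Burnside's condition holds,
transfer maps `G` onto `P`, and for noncyclic `P` the cup product of the two coordinates is such a
cocycle (`schur_of_normalizer_le_centralizer`). Or `p = 2`, and an element of the normalizer acts on
`P` without fixed points; then the cocycle is inflated from a nonabelian quotient of order 12 with
normal Sylow 2-subgroup, where it comes from an invariant bilinear form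
(`exists_twoCocycle_of_card_twelve`). For order `pq²` with commutator subgroup of order `q`, the
action of `G` on its normal Sylow `q`-subgroup forces symmetry. -/

/-! ### 2-cocycles, central extensions and transfer -/

/-- A 2-cocycle of `G` with values in the trivial `G`-module `A`. -/
structure TwoCocycle (G A : Type*) [Group G] [AddCommGroup A] where
  toFun : G → G → A
  cocycle : ∀ g h j, toFun (g * h) j + toFun g h = toFun h j + toFun g (h * j)

namespace TwoCocycle

variable {G A : Type*} [Group G] [AddCommGroup A]

instance : CoeFun (TwoCocycle G A) fun _ => G → G → A := ⟨TwoCocycle.toFun⟩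

/-- The integer `n` annihilates the cohomology class of `f`. -/
def Kills (f : TwoCocycle G A) (n : ℤ) : Prop :=
  ∃ b : G → A, ∀ g h, n • f g h = b g + b h - b (g * h)

/-- The inflation of a 2-cocycle along a homomorphism. -/
def comap {H : Type*} [Group H] (f : TwoCocycle H A) (π : G →* H) : TwoCocycle G A where
  toFun g h := f (π g) (π h)
  cocycle g h j := by simpa using f.cocycle (π g) (π h) (π j)

theorem one_left (f : TwoCocycle G A) (g : G) : f 1 g = f 1 1 := by
  have := f.cocycle 1 1 g
  simp only [one_mul] at this
  exact (add_left_cancel this).symm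

theorem one_right (f : TwoCocycle G A) (g : G) : f g 1 = f 1 1 := by
  have := f.cocycle g 1 1
  simp only [mul_one] at this
  exact add_right_cancel this

/-- The annihilating integers form an ideal of ℤ, and a proper ideal lies in `(ℓ)` for some prime
`ℓ`. -/
theorem Kills.one_of_forall_prime {f : TwoCocycle G A} 
    (h : ∀ ℓ : ℕ, ℓ.Prime → ∃ n : ℕ, ¬ ℓ ∣ n ∧ f.Kills n) : f.Kills 1 := by
  let I : Ideal ℤ :=
    { carrier := {n | f.Kills n}
      add_mem' := by
        rintro m n ⟨b, hb⟩ ⟨c, hc⟩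
        refine ⟨fun g => b g + c g, fun g h => ?_⟩
        rw [add_smul, hb, hc]
        dsimp only
        abel
      zero_mem' := ⟨0, by simp⟩
      smul_mem' := by
        rintro m n ⟨b, hb⟩
        refine ⟨fun g => m • b g, fun g h => ?_⟩
        rw [smul_eq_mul, mul_smul, hb, smul_sub, smul_add] }
  suffices I = ⊤ by
    have h1 : (1 : ℤ) ∈ I := by rw [this]; trivial
    exact h1
  by_contra hI
  obtain ⟨a, ha⟩ := (IsPrincipalIdealRing.principal I).principal
  rw [Ideal.submodule_span_eq] at ha
  have h1 : a.natAbs ≠ 1 := fun h1 => hI (by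
    rw [ha]; exact Ideal.span_singleton_eq_top.2 (Int.isUnit_iff_natAbs_eq.2 h1))
  -- The zero ideal is included: `Nat.minFac 0 = 2`.
  obtain ⟨n, hn, hk⟩ := h _ (Nat.minFac_prime h1)
  have hmem : (n : ℤ) ∈ I := hk
  rw [ha, Ideal.mem_span_singleton] at hmem
  exact hn ((Nat.minFac_dvd _).trans (Int.natAbs_dvd_natAbs.2 hmem))

/-- The central extension of `G` by `A` attached to a 2-cocycle. -/
@[ext]
structure Ext (f : TwoCocycle G A) where
  fst : A
  snd : G

namespace Ext

variable {f : TwoCocycle G A}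

instance : Mul f.Ext := ⟨fun x y => ⟨x.fst + y.fst + f x.snd y.snd, x.snd * y.snd⟩⟩
-- Cocycles are not normalized, so `f 1 1` enters the identity, the inverse and the inclusion of
-- `A`.
instance : One f.Ext := ⟨⟨-f 1 1, 1⟩⟩
instance : Inv f.Ext := ⟨fun x => ⟨-x.fst - f x.snd⁻¹ x.snd - f 1 1, x.snd⁻¹⟩⟩

theorem mul_def (x y : f.Ext) : x * y = ⟨x.fst + y.fst + f x.snd y.snd, x.snd * y.snd⟩ := rfl
theorem one_def : (1 : f.Ext) = ⟨-f 1 1, 1⟩ := rfl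
theorem inv_def (x : f.Ext) : x⁻¹ = ⟨-x.fst - f x.snd⁻¹ x.snd - f 1 1, x.snd⁻¹⟩ := rfl

instance : Group f.Ext :=
  Group.ofLeftAxioms
    (fun x y z => by
      have := f.cocycle x.snd y.snd z.snd
      ext
      · simp only [mul_def]
        calc _ = x.fst + y.fst + z.fst + (f (x.snd * y.snd) z.snd + f x.snd y.snd) := by abel
          _ = _ := by rw [this]; abel
      · simp only [mul_def, mul_assoc])
    (fun x => by
      ext
      · simp only [mul_def, one_def, f.one_left]; abel
      · simp only [mul_def, one_def, one_mul])
    (fun x => by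
      ext
      · simp only [mul_def, one_def, inv_def]; abel
      · simp only [mul_def, one_def, inv_def, inv_mul_cancel])

/-- The projection of the extension onto `G`. -/
def proj (f : TwoCocycle G A) : f.Ext →* G where
  toFun := Ext.snd
  map_one' := rfl
  map_mul' _ _ := rfl

/-- The inclusion of the central kernel. -/
def incl (f : TwoCocycle G A) : Multiplicative A →* f.Ext where
  toFun a := ⟨a.toAdd - f 1 1, 1⟩
  map_one' := by simp [one_def]
  map_mul' a b := by
    ext
    · simp only [mul_def, toAdd_mul]; abel
    · simp [mul_def]

theorem proj_surjective : Function.Surjective (proj f) := fun g => ⟨⟨0, g⟩, rfl⟩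

@[simp] theorem proj_incl (a : Multiplicative A) : proj f (incl f a) = 1 := rfl

theorem incl_injective : Function.Injective (incl f) := fun a b h => by
  have := congrArg Ext.fst h
  exact Multiplicative.toAdd.injective (sub_left_injective this)

theorem incl_mul_mk (a : Multiplicative A) (b : A) (g : G) :
    incl f a * ⟨b, g⟩ = ⟨a.toAdd + b, g⟩ := by
  ext
  · simp only [mul_def, incl, MonoidHom.coe_mk, OneHom.coe_mk, f.one_left]; abel
  · simp [mul_def, incl]

theorem exists_eq_incl_mul {x y : f.Ext} (h : proj f x = proj f y) : ∃ a, x = incl f a * y := by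
  obtain ⟨a, g⟩ := x
  obtain ⟨b, g'⟩ := y
  obtain rfl : g = g' := h
  exact ⟨.ofAdd (a - b), by rw [incl_mul_mk]; simp⟩

theorem incl_commute (a : Multiplicative A) (x : f.Ext) : Commute (incl f a) x := by
  obtain ⟨b, g⟩ := x
  show incl f a * _ = _ * incl f a
  rw [incl_mul_mk]
  ext
  · simp only [mul_def, incl, MonoidHom.coe_mk, OneHom.coe_mk, f.one_right]; abel
  · simp [mul_def, incl]

theorem mk_mul_mk (g h : G) :
    (⟨0, g⟩ : f.Ext) * ⟨0, h⟩ = incl f (.ofAdd (f g h)) * ⟨0, g * h⟩ := by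
  rw [incl_mul_mk]; simp [mul_def]

/-- Composing `σ` with the set-theoretic section `g ↦ (0, g)` gives a 1-cochain with coboundary `n •
f`. -/
theorem kills_of_hom (n : ℤ) (σ : f.Ext →* Multiplicative A) (hσ : ∀ a, σ (incl f a) = a ^ n) :
    f.Kills n := by
  refine ⟨fun g => (σ ⟨0, g⟩).toAdd, fun g h => ?_⟩
  have := congrArg (fun x => (σ x).toAdd) (mk_mul_mk (f := f) g h)
  simp only [map_mul, hσ, toAdd_mul, toAdd_zpow, toAdd_ofAdd] at this
  rw [this]; abel

/-- The transfer of the retraction `φ` sends a central element `a` to its power of exponent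
`H.index`. -/
theorem kills_index (H : Subgroup G) [H.FiniteIndex]
    (φ : H.comap (proj f) →* Multiplicative A)
    (hφ : ∀ a h, φ ⟨incl f a, h⟩ = a) : f.Kills H.index := by
  have hi : (H.comap (proj f)).index = H.index := H.index_comap_of_surjective proj_surjective
  have : (H.comap (proj f)).FiniteIndex := ⟨hi ▸ Subgroup.FiniteIndex.index_ne_zero⟩
  refine kills_of_hom _ (MonoidHom.transfer φ) fun a => ?_
  rw [MonoidHom.transfer_eq_pow φ (incl f a) fun k g _ => by
    rw [← map_pow, mul_assoc, (incl_commute _ g).eq, inv_mul_cancel_left]]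
  simp_rw [← map_pow]
  rw [hφ, hi, zpow_natCast]

theorem mul_comm_of_symm {g h : G} (hc : g * h = h * g) (hf : f g h = f h g) (x y : f.Ext)
    (hx : proj f x = g) (hy : proj f y = h) : x * y = y * x := by
  obtain ⟨a, g⟩ := x
  obtain ⟨b, h⟩ := y
  subst hx hy
  ext
  · simp only [mul_def]
    have : f g h = f h g := hf
    rw [this]; abel
  · exact hc

end Ext

theorem kills_index_of_comm (f : TwoCocycle G (AddCircle (1 : ℚ))) (H : Subgroup G)
    [H.FiniteIndex] (hc : ∀ x y : f.Ext, Ext.proj f x ∈ H → Ext.proj f y ∈ H → x * y = y * x) :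
    f.Kills H.index := by
  let E := H.comap (Ext.proj f)
  let : CommGroup E := { (inferInstance : Group E) with
    mul_comm := fun x y => Subtype.ext (hc x y x.2 y.2) }
  let i : AddCircle (1 : ℚ) →+ Additive E :=
    { toFun := fun a => .ofMul ⟨Ext.incl f (.ofAdd a), by simp [E, Subgroup.mem_comap, H.one_mem]⟩
      map_zero' := by
        apply Additive.toMul.injective
        exact Subtype.ext (map_one (Ext.incl f))
      map_add' := fun a b => by
        apply Additive.toMul.injective
        exact Subtype.ext ((Ext.incl f).map_mul (.ofAdd a) (.ofAdd b)) }
  have hi : Function.Injective i := fun a b h =>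
    Multiplicative.ofAdd.injective (Ext.incl_injective (congrArg (fun x => (x.toMul : f.Ext)) h))
  -- The identity of ℚ/ℤ is a character of ℚ/ℤ, so it extends to the abelian group `E`.
  obtain ⟨χ, hχ⟩ := CharacterModule.dual_surjective_of_injective i.toIntLinearMap hi
    (AddMonoidHom.id _)
  have hχ' : ∀ a, χ (i a) = a := fun a => DFunLike.congr_fun hχ a
  refine Ext.kills_index H
    { toFun := fun x => .ofAdd (χ (.ofMul x))
      map_one' := by
        apply Multiplicative.toAdd.injective
        exact map_zero χ
      map_mul' := fun x y => by
        apply Multiplicative.toAdd.injective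
        exact map_add χ _ _ } fun a h => ?_
  apply Multiplicative.toAdd.injective
  exact hχ' a.toAdd

end TwoCocycle

open groupHomology TwoCocycle

/-! ### Duality between `H₂` and 2-cocycles -/

section

variable {G : Type} [Group G]

namespace TwoCocycle

variable {A : Type*} [AddCommGroup A]

/-- The pairing of a 2-cocycle with integral 2-chains. -/
noncomputable def pairing (f : TwoCocycle G A) : (G × G →₀ ℤ) →ₗ[ℤ] A :=
  Finsupp.linearCombination ℤ fun p => f p.1 p.2

theorem pairing_single (f : TwoCocycle G A) (g h : G) (n : ℤ) :
    f.pairing (Finsupp.single (g, h) n) = n • f g h := by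
  simp [pairing]

theorem pairing_of_mem_boundaries (f : TwoCocycle G A) (x : G × G →₀ ℤ)
    (hx : x ∈ boundaries₂ (Rep.trivial ℤ G ℤ)) : f.pairing x = 0 := by
  obtain ⟨y, rfl⟩ := hx
  suffices f.pairing ∘ₗ (d₃₂ (Rep.trivial ℤ G ℤ)).hom = 0 from LinearMap.congr_fun this y
  refine Finsupp.lhom_ext' fun p => LinearMap.ext_ring ?_
  obtain ⟨g, h, j⟩ := p
  have := d₃₂_single (A := Rep.trivial ℤ G ℤ) (g, h, j) (1 : ℤ)
  have h2 := congrArg f.pairing this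
  refine h2.trans ?_
  erw [map_sub, map_add, map_sub]
  erw [pairing_single, pairing_single, pairing_single, pairing_single]
  have hc := f.cocycle g h j
  simp only [Representation.isTrivial_def, LinearMap.id_apply, one_smul]
  rw [LinearMap.zero_comp, LinearMap.zero_apply, sub_add_eq_add_sub, ← hc]
  abel

theorem exists_hom_H2 (f : TwoCocycle G A) : ∃ φ : schurMultiplier G →+ A,
    ∀ z : cycles₂ (Rep.trivial ℤ G ℤ), φ (H2π (Rep.trivial ℤ G ℤ) z) = f.pairing z.1 := by
  have hs : Function.Surjective (H2π (Rep.trivial ℤ G ℤ)).hom.toAddMonoidHom :=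
    (ModuleCat.epi_iff_surjective _).1 inferInstance
  refine ⟨AddMonoidHom.liftOfSurjective _ hs ⟨(f.pairing.comp
    (cycles₂ (Rep.trivial ℤ G ℤ)).subtype).toAddMonoidHom, fun z hz => ?_⟩, fun z => ?_⟩
  · exact f.pairing_of_mem_boundaries _ ((H2π_eq_zero_iff z).1 hz)
  · exact AddMonoidHom.liftOfRightInverse_comp_apply _ _ (Function.rightInverse_surjInv hs) _ z

/-- The 1-chain boundary of an integral 2-cycle vanishes. -/
theorem boundary_eq_zero (b : G → A) (x : G × G →₀ ℤ) (hx : x ∈ cycles₂ (Rep.trivial ℤ G ℤ)) :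
    Finsupp.linearCombination ℤ (fun p : G × G => b p.1 + b p.2 - b (p.1 * p.2)) x = 0 := by
  have h0 : d₂₁ (Rep.trivial ℤ G ℤ) x = 0 := hx
  have h1 := congrArg (Finsupp.linearCombination ℤ b) h0
  refine Eq.trans ?_ (h1.trans (map_zero _))
  suffices _ = Finsupp.linearCombination ℤ b ∘ₗ (d₂₁ (Rep.trivial ℤ G ℤ)).hom from
    LinearMap.congr_fun this x
  refine Finsupp.lhom_ext' fun p => LinearMap.ext_ring ?_
  have h2 := congrArg (Finsupp.linearCombination ℤ b)
    (d₂₁_single (A := Rep.trivial ℤ G ℤ) p (1 : ℤ))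
  refine Eq.trans ?_ h2.symm
  erw [map_add, map_sub]
  erw [Finsupp.linearCombination_single, Finsupp.linearCombination_single,
    Finsupp.linearCombination_single]
  simp only [Representation.isTrivial_def, LinearMap.id_apply, one_smul]
  simp
  abel

theorem pairing_eq_zero_of_kills (f : TwoCocycle G A) (hf : f.Kills 1) (x : G × G →₀ ℤ)
    (hx : x ∈ cycles₂ (Rep.trivial ℤ G ℤ)) : f.pairing x = 0 := by
  obtain ⟨b, hb⟩ := hf
  rw [← boundary_eq_zero b x hx, pairing]
  congr 2
  ext p
  rw [← hb, one_smul]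

/-- Every character of the Schur multiplier comes from a 2-cocycle. -/
theorem exists_of_character (φ : schurMultiplier G →+ AddCircle (1 : ℚ)) :
    ∃ f : TwoCocycle G (AddCircle (1 : ℚ)), ∀ z : cycles₂ (Rep.trivial ℤ G ℤ),
      φ (H2π (Rep.trivial ℤ G ℤ) z) = f.pairing z.1 := by
  -- Injectivity of ℚ/ℤ extends the character from cycles to all 2-chains; its vanishing on
  -- boundaries is the cocycle identity.
  obtain ⟨χ, hχ⟩ := CharacterModule.dual_surjective_of_injective
    (cycles₂ (Rep.trivial ℤ G ℤ)).subtype (Submodule.subtype_injective _)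
    (φ.comp (H2π (Rep.trivial ℤ G ℤ)).hom.toAddMonoidHom)
  have hχ' : ∀ z : cycles₂ (Rep.trivial ℤ G ℤ),
    χ z.1 = φ (H2π (Rep.trivial ℤ G ℤ) z) := fun z => DFunLike.congr_fun hχ z
  have hb : ∀ x : G × G →₀ ℤ, x ∈ boundaries₂ (Rep.trivial ℤ G ℤ) → χ x = 0 := fun x hx => by
    have h := hχ' ⟨x, boundaries₂_le_cycles₂ _ hx⟩
    rw [(H2π_eq_zero_iff _).2 hx, map_zero] at h
    exact h
  refine ⟨⟨fun g h => χ (Finsupp.single (g, h) (1 : ℤ)), fun g h j => ?_⟩, fun z => ?_⟩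
  · have h0 := hb _ ⟨Finsupp.single (g, h, j) (1 : ℤ), rfl⟩
    have h1 := d₃₂_single (A := Rep.trivial ℤ G ℤ) (g, h, j) (1 : ℤ)
    erw [h1, map_sub, map_add, map_sub] at h0
    simp only [Representation.isTrivial_def, LinearMap.id_apply] at h0
    exact (sub_eq_zero.1 (by rw [← h0]; abel)).symm
  · rw [← hχ']
    suffices χ.toIntLinearMap = pairing _ from LinearMap.congr_fun this z.1
    refine Finsupp.lhom_ext' fun p => LinearMap.ext_ring ?_
    simp only [LinearMap.comp_apply, Finsupp.lsingle_apply]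
    rw [pairing_single, one_smul]
    rfl

end TwoCocycle

theorem schurIsZero_of_kills (h : ∀ f : TwoCocycle G (AddCircle (1 : ℚ)), f.Kills 1) :
    SchurIsZero G := by
  refine ⟨fun a b => sub_eq_zero.1 (CharacterModule.eq_zero_of_character_apply fun φ => ?_)⟩
  obtain ⟨f, hf⟩ := exists_of_character φ
  induction a - b using H2_induction_on with
  | h z => exact (hf z).trans (f.pairing_eq_zero_of_kills (h f) _ z.2)

/-- The 2-cycle `[x|y] - [y|x]` of a commuting pair. -/
theorem commuting_mem_cycles {x y : G} (h : x * y = y * x) :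
    (Finsupp.single (x, y) (1 : ℤ) - Finsupp.single (y, x) (1 : ℤ) : G × G →₀ ℤ) ∈
      cycles₂ (Rep.trivial ℤ G ℤ) := by
  have h1 := d₂₁_single (A := Rep.trivial ℤ G ℤ) (x, y) (1 : ℤ)
  have h2 := d₂₁_single (A := Rep.trivial ℤ G ℤ) (y, x) (1 : ℤ)
  show d₂₁ (Rep.trivial ℤ G ℤ) _ = 0
  erw [map_sub, h1, h2]
  simp only [Representation.isTrivial_def, LinearMap.id_apply, h]
  abel

/-- If every character class is killed as soon as it is symmetric on the commuting pair `x, y`,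
and its value on this pair has order dividing the prime `p`, then the Schur multiplier is trivial
or cyclic of order `p`; it is nontrivial if some 2-cocycle is not symmetric on `x, y`. -/
theorem schur_zero_or_zmod {p : ℕ} (hp : p.Prime) {x y : G} (hxy : x * y = y * x)
    (h0 : ∀ f : TwoCocycle G (AddCircle (1 : ℚ)), f x y = f y x → f.Kills 1)
    (h1 : ∀ f : TwoCocycle G (AddCircle (1 : ℚ)), p • (f x y - f y x) = 0) :
    (SchurIsZero G ∨ SchurIsZMod G p) ∧
      ∀ {A : Type} [AddCommGroup A] (f : TwoCocycle G A), f x y ≠ f y x → SchurIsZMod G p := by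
  have : Fact p.Prime := ⟨hp⟩
  let z : cycles₂ (Rep.trivial ℤ G ℤ) := ⟨_, commuting_mem_cycles hxy⟩
  let c : schurMultiplier G := H2π (Rep.trivial ℤ G ℤ) z
  have hz : ∀ {A : Type} [AddCommGroup A] (f : TwoCocycle G A),
      f.pairing z.1 = f x y - f y x := fun f => by
    refine (map_sub f.pairing _ _).trans ?_
    rw [pairing_single, pairing_single, one_smul, one_smul]
  have hc : p • c = 0 := CharacterModule.eq_zero_of_character_apply fun φ => by
    obtain ⟨f, hf⟩ := exists_of_character φ
    refine (map_nsmul φ p c).trans ?_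
    rw [show φ c = _ from hf z, hz, h1]
  -- A character of the quotient by `⟨c⟩` pulls back to a cocycle symmetric on `x, y`, which is a
  -- coboundary; so the quotient has no nonzero character.
  have hgen : ∀ a : schurMultiplier G, a ∈ AddSubgroup.zmultiples c := fun a => by
    rw [← QuotientAddGroup.eq_zero_iff]
    refine CharacterModule.eq_zero_of_character_apply fun φ => ?_
    obtain ⟨f, hf⟩ := exists_of_character (φ.comp (QuotientAddGroup.mk' _))
    have hfc : f x y - f y x = 0 := by
      rw [← hz, ← hf z]
      show φ (QuotientAddGroup.mk c) = 0
      rw [(QuotientAddGroup.eq_zero_iff c).2 (AddSubgroup.mem_zmultiples c), map_zero]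
    induction a using H2_induction_on with
    | h w => exact (hf w).trans (f.pairing_eq_zero_of_kills (h0 f (sub_eq_zero.1 hfc)) _ w.2)
  have key : c ≠ 0 → SchurIsZMod G p := fun hne => by
    have ho : addOrderOf c = p := addOrderOf_eq_prime hc hne
    have hcard : Nat.card (schurMultiplier G) = p := by
      rw [← ho, ← Nat.card_zmultiples, (AddSubgroup.eq_top_iff' _).2 hgen, AddSubgroup.card_top]
    have : IsAddCyclic (schurMultiplier G) := ⟨c, hgen⟩
    exact ⟨(zmodAddCyclicAddEquiv this).symm.trans (ZMod.ringEquivCongr hcard).toAddEquiv⟩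
  refine ⟨?_, fun f hf => key fun h => hf ?_⟩
  · by_cases h : c = 0
    · refine Or.inl ⟨fun a b => ?_⟩
      have : ∀ a : schurMultiplier G, a = 0 := fun a => by
        simpa [h, AddSubgroup.mem_bot] using hgen a
      rw [this a, this b]
    · exact Or.inr (key h)
  · obtain ⟨φ, hφ⟩ := f.exists_hom_H2
    rw [← sub_eq_zero, ← hz, ← hφ z]
    show φ c = 0
    rw [h, map_zero]

end

/-! ### Commutators in the extension and reduction to Sylow subgroups -/

section

variable {G : Type} [Group G]

namespace TwoCocycle

variable {A : Type*} [AddCommGroup A]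

/-- The commutator of two lifts does not depend on the lifts, as the kernel is central. -/
theorem Ext.commutator_eq (f : TwoCocycle G A) {x y : G} (hxy : x * y = y * x) (X Y : f.Ext)
    (hX : proj f X = x) (hY : proj f Y = y) :
    X * Y = incl f (.ofAdd (f x y - f y x)) * (Y * X) := by
  obtain ⟨a, x⟩ := X
  obtain ⟨b, y⟩ := Y
  subst hX hY
  rw [mul_def ⟨b, y⟩, incl_mul_mk]
  ext
  · simp only [mul_def, toAdd_ofAdd]
    show a + b + f x y = f x y - f y x + (b + a + f y x)
    abel
  · exact hxy

theorem Ext.zpow_mul_eq {f : TwoCocycle G A} {X Y : f.Ext} {w : Multiplicative A}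
    (h : X * Y = incl f w * (Y * X)) (n : ℤ) : X * Y ^ n = incl f (w ^ n) * (Y ^ n * X) := by
  have h1 : X * Y * X⁻¹ = incl f w * Y := by rw [h]; group
  have h2 : X * Y ^ n * X⁻¹ = incl f (w ^ n) * Y ^ n := by
    rw [← conj_zpow, h1, (incl_commute w Y).mul_zpow, map_zpow]
  rw [← mul_assoc, ← h2, inv_mul_cancel_right]

/-- The alternating pairing of a 2-cocycle on commuting elements is annihilated by the order of
the second one. -/
theorem nsmul_sub_eq_zero (f : TwoCocycle G A) {x y : G} (hxy : x * y = y * x) {n : ℕ}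
    (hy : y ^ n = 1) : n • (f x y - f y x) = 0 := by
  let X : f.Ext := ⟨0, x⟩
  let Y : f.Ext := ⟨0, y⟩
  have h := Ext.zpow_mul_eq (Ext.commutator_eq f hxy X Y rfl rfl) n
  obtain ⟨a, ha⟩ := Ext.exists_eq_incl_mul (f := f) (x := Y ^ n) (y := 1)
    (by rw [map_pow, map_one]; exact hy)
  rw [zpow_natCast, zpow_natCast, ha, mul_one, (Ext.incl_commute a X).eq] at h
  have h2 := Ext.incl_injective ((mul_eq_right.1 h.symm).trans (map_one _).symm)
  exact h2

theorem comm_of_generators (f : TwoCocycle G A) {x y : G} (hxy : x * y = y * x)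
    (hf : f x y = f y x) {H : Subgroup G} (hH : ∀ g ∈ H, ∃ i j : ℤ, g = x ^ i * y ^ j) (u v : f.Ext)
    (hu : Ext.proj f u ∈ H) (hv : Ext.proj f v ∈ H) : u * v = v * u := by
  let X : f.Ext := ⟨0, x⟩
  let Y : f.Ext := ⟨0, y⟩
  have hXY : Commute X Y := Ext.mul_comm_of_symm hxy hf X Y rfl rfl
  obtain ⟨i, j, hi⟩ := hH _ hu
  obtain ⟨k, l, hk⟩ := hH _ hv
  obtain ⟨a, rfl⟩ := Ext.exists_eq_incl_mul (x := u) (y := X ^ i * Y ^ j)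
    (by rw [hi, map_mul, map_zpow, map_zpow]; rfl)
  obtain ⟨b, rfl⟩ := Ext.exists_eq_incl_mul (x := v) (y := X ^ k * Y ^ l)
    (by rw [hk, map_mul, map_zpow, map_zpow]; rfl)
  have h1 : Commute (X ^ i * Y ^ j) (X ^ k * Y ^ l) :=
    ((Commute.refl X).zpow_zpow i k |>.mul_right (hXY.zpow_zpow i l)).mul_left
      ((hXY.symm.zpow_zpow j k).mul_right ((Commute.refl Y).zpow_zpow j l))
  exact ((Ext.incl_commute a _).mul_left ((Ext.incl_commute b _).symm.mul_right h1))

theorem kills_index_of_isCyclic (f : TwoCocycle G (AddCircle (1 : ℚ))) (H : Subgroup G)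
    [H.FiniteIndex] [IsCyclic H] : f.Kills H.index := by
  obtain ⟨x, hx⟩ := IsCyclic.exists_generator (α := H)
  refine f.kills_index_of_comm H (f.comm_of_generators (x := (x : G)) (y := x) rfl rfl ?_)
  intro g hg
  obtain ⟨i, hi⟩ := hx ⟨g, hg⟩
  exact ⟨i, 0, by simpa using (congrArg Subtype.val hi).symm⟩

end TwoCocycle

variable [Finite G]

theorem schurIsZero_of_isZGroup [IsZGroup G] : SchurIsZero G := by
  refine schurIsZero_of_kills fun f => Kills.one_of_forall_prime fun ℓ hℓ => ?_
  have : Fact ℓ.Prime := ⟨hℓ⟩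
  obtain ⟨P⟩ : Nonempty (Sylow ℓ G) := inferInstance
  exact ⟨_, P.not_dvd_index, f.kills_index_of_isCyclic P⟩

/-- At `p`, symmetry on the generators `x, y` makes the preimage of `P` abelian; at the other primes
the Sylow subgroups are cyclic. In each case the index is prime to the prime in question. -/
theorem schur_of_sylow {p : ℕ} [Fact p.Prime] (P : Sylow p G)
    (hG : ∀ ℓ : ℕ, ℓ.Prime → ℓ ≠ p → ∀ Q : Sylow ℓ G, IsCyclic Q)
    {x y : G} (hxy : x * y = y * x) (hP : ∀ g ∈ P, ∃ i j : ℤ, g = x ^ i * y ^ j) (hy : y ^ p = 1) :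
    ((∀ f : TwoCocycle G (AddCircle (1 : ℚ)), f x y = f y x) → SchurIsZero G) ∧
    (SchurIsZero G ∨ SchurIsZMod G p) ∧
      ∀ {A : Type} [AddCommGroup A] (f : TwoCocycle G A), f x y ≠ f y x → SchurIsZMod G p := by
  have h0 : ∀ f : TwoCocycle G (AddCircle (1 : ℚ)), f x y = f y x → f.Kills 1 := fun f hf => by
    refine Kills.one_of_forall_prime fun ℓ hℓ => ?_
    by_cases h : ℓ = p
    · subst h
      exact ⟨_, P.not_dvd_index, f.kills_index_of_comm P (f.comm_of_generators hxy hf hP)⟩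
    · have : Fact ℓ.Prime := ⟨hℓ⟩
      obtain ⟨Q⟩ : Nonempty (Sylow ℓ G) := inferInstance
      have := hG ℓ hℓ h Q
      exact ⟨_, Q.not_dvd_index, f.kills_index_of_isCyclic Q⟩
  exact ⟨fun h => schurIsZero_of_kills fun f => h0 f (h f),
    schur_zero_or_zmod Fact.out hxy h0 fun f => f.nsmul_sub_eq_zero hxy hy⟩

end

/-! ### Groups of order `p²` and their automorphisms -/

section PrimeSquare

variable {P : Type*} [Group P] {p : ℕ} [hp : Fact p.Prime]

theorem pow_eq_one_of_card_prime_sq (h : Nat.card P = p ^ 2) (hc : ¬ IsCyclic P) (x : P) :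
    x ^ p = 1 := by
  have : Finite P := Nat.finite_of_card_ne_zero (by rw [h]; exact pow_ne_zero _ hp.out.ne_zero)
  obtain ⟨k, hk, ho⟩ := (Nat.dvd_prime_pow hp.out).1 (h ▸ orderOf_dvd_natCard x)
  have hk2 : k ≠ 2 := by
    rintro rfl
    exact hc (isCyclic_of_orderOf_eq_card x (by rw [ho, h]))
  rw [← orderOf_dvd_iff_pow_eq_one, ho]
  exact (pow_dvd_pow p (by omega : k ≤ 1)).trans (by rw [pow_one])

theorem exists_zpow_mul_zpow_of_card_prime_sq (h : Nat.card P = p ^ 2) {x y : P} (hx : x ≠ 1)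
    (hy : y ∉ Subgroup.zpowers x) (g : P) : ∃ i j : ℤ, g = x ^ i * y ^ j := by
  have : Finite P := Nat.finite_of_card_ne_zero (by rw [h]; exact pow_ne_zero _ hp.out.ne_zero)
  let : CommGroup P := { (inferInstance : Group P) with
    mul_comm := (IsPGroup.isMulCommutative_of_card_eq_prime_sq h).is_comm.comm }
  let H := Subgroup.zpowers x ⊔ Subgroup.zpowers y
  obtain ⟨k, hk, ho⟩ := (Nat.dvd_prime_pow hp.out).1 (h ▸ (Subgroup.zpowers x).card_subgroup_dvd_card)
  obtain ⟨l, hl, hH⟩ := (Nat.dvd_prime_pow hp.out).1 (h ▸ H.card_subgroup_dvd_card)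
  have hlt : Subgroup.zpowers x < H := lt_of_le_of_ne le_sup_left fun e =>
    hy (e ▸ (le_sup_right : Subgroup.zpowers y ≤ H) (Subgroup.mem_zpowers y))
  have h1 : p ^ k < p ^ l := by
    rw [← ho, ← hH]
    exact Set.ncard_lt_ncard hlt
  have h2 : k ≠ 0 := by
    rintro rfl
    rw [pow_zero, Subgroup.card_eq_one, Subgroup.zpowers_eq_bot] at ho
    exact hx ho
  have h3 := (Nat.pow_lt_pow_iff_right hp.out.one_lt).1 h1
  have hT : H = ⊤ := Subgroup.eq_top_of_card_eq _ (by rw [hH, h]; congr; omega)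
  obtain ⟨a, ⟨i, rfl⟩, b, ⟨j, rfl⟩, e⟩ := Subgroup.mem_sup.1 (hT ▸ Subgroup.mem_top g : g ∈ H)
  exact ⟨i, j, e.symm⟩

theorem nonempty_addEquiv_of_card_prime_sq {V : Type*} [AddCommGroup V] [Module (ZMod p) V]
    (h : Nat.card V = p ^ 2) : Nonempty (V ≃+ ZMod p × ZMod p) := by
  have : Finite V := Nat.finite_of_card_ne_zero (by rw [h]; exact pow_ne_zero _ hp.out.ne_zero)
  have : Module.Finite (ZMod p) V := Module.Finite.of_finite
  have hf : Module.finrank (ZMod p) V = 2 :=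
    Nat.pow_right_injective hp.out.two_le ((FiniteField.pow_finrank_eq_natCard p V).trans h)
  obtain ⟨e⟩ := FiniteDimensional.nonempty_linearEquiv_of_finrank_eq (R := ZMod p)
    (M := V) (M' := ZMod p × ZMod p) (by rw [hf]; simp)
  exact ⟨e.toAddEquiv⟩

theorem isoAdd_prod_of_card_prime_sq (h : Nat.card P = p ^ 2) (hc : ¬ IsCyclic P) :
    IsoAdd P (ZMod p × ZMod p) := by
  let : CommGroup P := { (inferInstance : Group P) with
    mul_comm := (IsPGroup.isMulCommutative_of_card_eq_prime_sq h).is_comm.comm }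
  let : Module (ZMod p) (Additive P) := AddCommGroup.zmodModule fun x =>
    pow_eq_one_of_card_prime_sq h hc x.toMul
  obtain ⟨e⟩ := nonempty_addEquiv_of_card_prime_sq (p := p) (V := Additive P) h
  exact ⟨AddEquiv.toMultiplicativeRight e⟩

/-- The fixed subgroup of `σ` has order congruent to `p²` modulo `ℓ`. Order `p²` would make `σ`
trivial, and order `p` would give `ℓ ∣ p(p - 1)`, against `p < ℓ`. So it is trivial and `ℓ ∣ (p +
1)(p - 1)`, whence `ℓ = p + 1`. -/
theorem fixedPointFree_of_orderOf_eq_prime (h : Nat.card P = p ^ 2) {σ : MulAut P} {ℓ : ℕ}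
    (hℓ : ℓ.Prime) (hσ : orderOf σ = ℓ) (hlt : p < ℓ) :
    p = 2 ∧ ℓ = 3 ∧ ∀ x, σ x = x → x = 1 := by
  have : Finite P := Nat.finite_of_card_ne_zero (by rw [h]; exact pow_ne_zero _ hp.out.ne_zero)
  have : Fact ℓ.Prime := ⟨hℓ⟩
  let S := Subgroup.zpowers σ
  have hS : IsPGroup ℓ S := IsPGroup.of_card (n := 1) (by rw [Nat.card_zpowers, hσ, pow_one])
  have hmod := hS.card_modEq_card_fixedPoints P
  let F : Subgroup P := FixedPoints.subgroup S P
  change Nat.card P ≡ Nat.card F [MOD ℓ] at hmod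
  have hF : ∀ x, σ x = x → x ∈ F := by
    rintro x hx ⟨_, i, rfl⟩
    exact (MulAction.mem_stabilizer_iff (G := MulAut P)).1
      (Subgroup.zpow_mem (MulAction.stabilizer (MulAut P) x) hx i)
  obtain ⟨k, hk, ho⟩ := (Nat.dvd_prime_pow hp.out).1 (h ▸ F.card_subgroup_dvd_card)
  rw [ho, h] at hmod
  have hdvd := (Nat.modEq_iff_dvd' (Nat.pow_le_pow_right hp.out.pos hk)).1 hmod.symm
  have hk2 : k ≠ 2 := by
    rintro rfl
    have hT : F = ⊤ := Subgroup.eq_top_of_card_eq _ (by rw [ho, h])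
    have : σ = 1 := MulEquiv.ext fun x =>
      (hT ▸ Subgroup.mem_top x : x ∈ F) ⟨σ, Subgroup.mem_zpowers σ⟩
    rw [this, orderOf_one] at hσ
    exact hℓ.one_lt.ne hσ
  have hp1 := hp.out.one_lt
  have hnd : ¬ ℓ ∣ p - 1 := Nat.not_dvd_of_pos_of_lt (by omega) (by omega)
  have hk1 : k ≠ 1 := by
    rintro rfl
    rw [pow_one, pow_two, ← Nat.mul_sub_one, hℓ.dvd_mul] at hdvd
    exact hdvd.elim (Nat.not_dvd_of_pos_of_lt (by omega) hlt) hnd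
  obtain rfl : k = 0 := by omega
  have hdvd' : ℓ ∣ (p + 1) * (p - 1) := by
    rw [pow_zero] at hdvd
    rwa [← Nat.sq_sub_sq, one_pow]
  have hdvd2 := (hℓ.dvd_mul.1 hdvd').resolve_right hnd
  have hle := Nat.le_of_dvd (by omega) hdvd2
  obtain rfl : ℓ = p + 1 := by omega
  have hp2 : p = 2 := by
    by_contra hne
    have h1 := hp.out.odd_of_ne_two hne
    have h2 := hℓ.odd_of_ne_two (by omega)
    exact (Nat.not_even_iff_odd.2 h2) h1.add_one
  refine ⟨hp2, by omega, fun x hx => ?_⟩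
  have hb : F = ⊥ := Subgroup.card_eq_one.1 ho
  exact Subgroup.mem_bot.1 (hb ▸ hF x hx)

end PrimeSquare

/-! ### Burnside's condition and its failure -/

section Burnside

variable {G : Type*} [Group G] [Finite G] {p : ℕ} [hp : Fact p.Prime]

/-- A Sylow subgroup of order `p²` for the smallest prime divisor `p` either satisfies Burnside's
condition, or `p = 2` and its normalizer permutes its involutions transitively. -/
theorem Sylow.normalizer_le_centralizer_or_of_card_sq (P : Sylow p G) (hP : Nat.card P = p ^ 2)
    (hmin : ∀ ℓ : ℕ, ℓ.Prime → ℓ ∣ Nat.card G → p ≤ ℓ) :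
    Subgroup.normalizer P ≤ Subgroup.centralizer (P : Set G) ∨
      (p = 2 ∧ 3 ∣ Nat.card (Subgroup.normalizer (P : Set G)) ∧ ¬ IsCyclic P ∧ ∃ g ∈ Subgroup.normalizer (P : Set G),
        ∀ x ∈ P, g * x * g⁻¹ = x → x = 1) := by
  refine or_iff_not_imp_left.2 fun hN => ?_
  have hcyc : ¬ IsCyclic P := fun hc => hN (by
    refine IsCyclic.normalizer_le_centralizer ?_ hc
    have hpd : p ∣ Nat.card G :=
      (dvd_pow_self p two_ne_zero).trans (hP ▸ P.1.card_subgroup_dvd_card)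
    refine le_antisymm (Nat.minFac_le_of_dvd hp.out.two_le hpd) (hmin _ (Nat.minFac_prime ?_)
      (Nat.minFac_dvd _))
    rintro h1
    exact hp.out.one_lt.ne' (Nat.dvd_one.1 (h1 ▸ hpd)))
  -- `K` is the normalizer modulo the centralizer. As `P` is abelian, `|K|` divides the index of
  -- `P`, so any prime divisor of `|K|` exceeds `p`.
  let K := P.1.normalizerMonoidHom.range
  have hcard : Nat.card K = (Subgroup.centralizer (P : Set G)).relIndex (Subgroup.normalizer P) := by
    rw [← Subgroup.index_ker, Subgroup.normalizerMonoidHom_ker]; rfl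
  have h1 : Nat.card K ≠ 1 := fun h => hN (Subgroup.relIndex_eq_one.1 (hcard ▸ h))
  have hcomm := (IsPGroup.isMulCommutative_of_card_eq_prime_sq hP).is_comm.comm
  have hPC : (P : Subgroup G) ≤ Subgroup.centralizer (P : Set G) := fun x hx y hy =>
    congrArg Subtype.val (hcomm ⟨y, hy⟩ ⟨x, hx⟩)
  have hdvd : Nat.card K ∣ P.index := hcard ▸
    (Subgroup.relIndex_dvd_of_le_left _ hPC).trans
      (Subgroup.relIndex_dvd_index_of_le Subgroup.le_normalizer)
  obtain ⟨ℓ, hℓ, hℓK⟩ := Nat.exists_prime_and_dvd h1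
  have hℓG : ℓ ∣ Nat.card G := (hℓK.trans hdvd).trans P.1.index_dvd_card
  have hne : ℓ ≠ p := by
    rintro rfl
    exact P.not_dvd_index (hℓK.trans hdvd)
  have : Fact ℓ.Prime := ⟨hℓ⟩
  obtain ⟨⟨σ, g, rfl⟩, hσ⟩ := exists_prime_orderOf_dvd_card' ℓ hℓK
  rw [← Subgroup.orderOf_coe] at hσ
  obtain ⟨h2, h3, hfix⟩ := fixedPointFree_of_orderOf_eq_prime hP hℓ hσ
    (lt_of_le_of_ne (hmin ℓ hℓ hℓG) hne.symm)
  exact ⟨h2, h3 ▸ hℓK.trans (Subgroup.card_range_dvd _), hcyc, g, g.2, fun x hx h => congrArg Subtype.val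
    (hfix ⟨x, hx⟩ (Subtype.ext h))⟩

/-- On the abelian group `P` the map `x ↦ [g, x]` is an endomorphism with trivial kernel, hence onto
by finiteness. -/
theorem le_commutator_of_fixedPointFree {P : Subgroup G} (hcomm : ∀ x ∈ P, ∀ y ∈ P, x * y = y * x)
    {g : G} (hg : g ∈ Subgroup.normalizer (P : Set G))
    (hfix : ∀ x ∈ P, g * x * g⁻¹ = x → x = 1) : P ≤ commutator G := by
  have hmem : ∀ x : P, g * x * g⁻¹ * (x : G)⁻¹ ∈ P := fun x =>
    P.mul_mem ((Subgroup.mem_normalizer_iff.1 hg x).1 x.2) (P.inv_mem x.2)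
  let φ : P →* P :=
    { toFun := fun x => ⟨_, hmem x⟩
      map_one' := by simp
      map_mul' := fun x y => Subtype.ext (by
        have h1 := hcomm (x : G)⁻¹ (P.inv_mem x.2) (g * y * g⁻¹)
          ((Subgroup.mem_normalizer_iff.1 hg y).1 y.2)
        have h2 := hcomm (y : G)⁻¹ (P.inv_mem y.2) (x : G)⁻¹ (P.inv_mem x.2)
        simp only [Subgroup.coe_mul, mul_inv_rev]
        calc g * (x * y) * g⁻¹ * ((y : G)⁻¹ * (x : G)⁻¹)
            = g * x * g⁻¹ * ((g * y * g⁻¹) * (x : G)⁻¹) * (y : G)⁻¹ := by rw [h2]; group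
          _ = _ := by rw [← h1]; group) }
  have hinj : Function.Injective φ := (injective_iff_map_eq_one φ).2 fun x hx =>
    Subtype.ext (hfix x x.2 (mul_inv_eq_one.1 (congrArg Subtype.val hx)))
  intro x hx
  obtain ⟨y, hy⟩ := Finite.surjective_of_injective hinj ⟨x, hx⟩
  rw [← show _ = x from congrArg Subtype.val hy]
  exact Subgroup.commutator_mem_commutator (Subgroup.mem_top g) (Subgroup.mem_top (y : G))

end Burnside

/-! ### Commutator subgroups and quotients -/

section Quotients

variable {G : Type*} [Group G]

theorem isoAdd_zmod_of_isCyclic {n : ℕ} (hc : IsCyclic G) (h : Nat.card G = n) :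
    IsoAdd G (ZMod n) := by
  subst h
  exact ⟨(zmodCyclicMulEquiv hc).symm⟩

theorem IsoAdd.card_eq {A : Type*} [AddGroup A] (h : IsoAdd G A) : Nat.card G = Nat.card A := by
  obtain ⟨e⟩ := h
  exact Nat.card_congr (e.toEquiv.trans Multiplicative.toAdd)

theorem commutator_le_of_comm {N : Subgroup G} [N.Normal]
    (h : ∀ a b : G ⧸ N, a * b = b * a) : commutator G ≤ N := by
  refine Subgroup.commutator_le.2 fun a _ b _ => ?_
  rw [← QuotientGroup.eq_one_iff]
  have := h a b
  show ((a * b * a⁻¹ * b⁻¹ : G) : G ⧸ N) = 1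
  rw [QuotientGroup.mk_mul, QuotientGroup.mk_mul, QuotientGroup.mk_mul, this]
  simp

theorem commutator_le_of_index_prime {N : Subgroup G} [N.Normal] {p : ℕ} (hp : p.Prime)
    (h : N.index = p) : commutator G ≤ N := by
  have : Fact p.Prime := ⟨hp⟩
  have : IsCyclic (G ⧸ N) := isCyclic_of_prime_card h
  exact commutator_le_of_comm IsCyclic.isMulCommutative.is_comm.comm

theorem mul_comm_of_le_center {N : Subgroup G} [N.Normal] {p : ℕ} (hp : p.Prime)
    (h : N.index = p) (hN : N ≤ Subgroup.center G) (a b : G) : a * b = b * a := by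
  have : Fact p.Prime := ⟨hp⟩
  have : IsCyclic (G ⧸ N) := isCyclic_of_prime_card h
  exact ((QuotientGroup.mk' N).isMulCommutative_of_isCyclic_of_ker_le_center
    (by simpa using hN)).is_comm.comm a b

theorem commutator_ne_bot (h : ∃ a b : G, a * b ≠ b * a) : commutator G ≠ ⊥ := by
  obtain ⟨a, b, hab⟩ := h
  refine fun hb => hab (commutatorElement_eq_one_iff_mul_comm.1 (Subgroup.mem_bot.1 (hb ▸ ?_)))
  exact Subgroup.commutator_mem_commutator (Subgroup.mem_top a) (Subgroup.mem_top b)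

end Quotients

/-! ### Sylow orders and a criterion for commutativity -/

section Cardinalities

variable {G : Type*} [Group G] [Finite G]

theorem Sylow.card_eq_of_card_eq_mul {p k m : ℕ} [hp : Fact p.Prime] (P : Sylow p G)
    (h : Nat.card G = p ^ k * m) (hm : ¬ p ∣ m) : Nat.card P = p ^ k := by
  have hm0 : m ≠ 0 := by rintro rfl; exact hm (dvd_zero p)
  rw [P.card_eq_multiplicity, h, Nat.factorization_mul (pow_ne_zero _ hp.out.ne_zero) hm0,
    hp.out.factorization_pow]
  simp [Nat.factorization_eq_zero_of_not_dvd hm]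

theorem Sylow.isCyclic_of_card_eq_mul {ℓ a m : ℕ} [hℓ : Fact ℓ.Prime] (Q : Sylow ℓ G)
    (h : Nat.card G = a * m) (ha : ¬ ℓ ∣ a) (hm : Squarefree m) : IsCyclic Q := by
  obtain ⟨k, hk⟩ := Q.2.exists_card_eq
  have hd : ℓ ^ k ∣ m := ((Nat.Prime.coprime_iff_not_dvd hℓ.out).2 ha).pow_left k |>.dvd_of_dvd_mul_left
    (h ▸ hk ▸ Q.1.card_subgroup_dvd_card)
  have : Nat.card Q ∣ ℓ := hk ▸ hm.pow_dvd_of_pow_dvd hd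
  exact isCyclic_of_card_dvd_prime this

theorem isZGroup_of_isCyclic_sylow {p : ℕ} [Fact p.Prime] (P : Sylow p G) (hP : IsCyclic P)
    (hG : ∀ ℓ : ℕ, ℓ.Prime → ℓ ≠ p → ∀ Q : Sylow ℓ G, IsCyclic Q) : IsZGroup G := by
  refine ⟨fun ℓ hℓ Q => ?_⟩
  by_cases h : ℓ = p
  · subst h
    exact isCyclic_of_surjective _ (P.equiv Q).surjective
  · exact hG ℓ hℓ h Q

/-- A finite group with an abelian normal subgroup of prime index larger than its order is
abelian. -/
theorem mul_comm_of_card_lt_index {K : Subgroup G} [K.Normal] {r : ℕ} (hr : r.Prime)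
    (hi : K.index = r) (hK : ∀ x ∈ K, ∀ y ∈ K, x * y = y * x) (hlt : Nat.card K < r) (a b : G) :
    a * b = b * a := by
  -- The image of `φ` has order dividing `r`, as `K` acts trivially on itself, and dividing `|K|!`,
  -- which is prime to `r`. So `φ` is trivial and `K` is central.
  let φ : G →* MulAut K := MulAut.conjNormal
  have hle : K ≤ φ.ker := fun x hx => MonoidHom.mem_ker.2 (MulEquiv.ext fun y => Subtype.ext (by
    simp only [φ, MulAut.conjNormal_apply, MulAut.one_apply]
    rw [hK x hx y y.2, mul_inv_cancel_right]))
  have h1 : φ.ker.index ∣ r := hi ▸ Subgroup.index_dvd_of_le hle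
  have h2 : φ.ker.index ∣ (Nat.card K).factorial := by
    rw [Subgroup.index_ker, ← Nat.card_perm]
    exact (Subgroup.card_subgroup_dvd_card _).trans
      (Subgroup.card_dvd_of_injective (MulAut.toPerm K) MulEquiv.toEquiv_injective)
  have h3 : φ.ker = ⊤ := by
    refine Subgroup.index_eq_one.1 (((Nat.dvd_prime hr).1 h1).resolve_right fun h => ?_)
    exact absurd ((hr.dvd_factorial).1 (h ▸ h2)) (by omega)
  refine mul_comm_of_le_center hr hi (fun x hx => Subgroup.mem_center_iff.2 fun g => ?_) a b
  have := MulEquiv.congr_fun (MonoidHom.mem_ker.1 (h3 ▸ Subgroup.mem_top g : g ∈ φ.ker)) ⟨x, hx⟩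
  have h4 : g * x * g⁻¹ = x := by
    simpa [φ] using congrArg Subtype.val this
  exact mul_inv_eq_iff_eq_mul.1 h4

end Cardinalities

/-! ### Explicit cocycles and invariance of the alternating pairing -/

section Cocycles

variable {G : Type} [Group G]

/-- The cup product of two homomorphisms to a commutative ring. -/
def TwoCocycle.cup {R : Type*} [CommRing R] (u v : G →* Multiplicative R) : TwoCocycle G R where
  toFun g h := (u g).toAdd * (v h).toAdd
  cocycle g h j := by simp only [map_mul, toAdd_mul]; ring

/-- The 2-cocycle of a semidirect product obtained from an invariant bilinear form. -/
def TwoCocycle.ofSemidirect {N K A : Type*} [Group N] [Group K] [AddCommGroup A]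
    (φ : K →* MulAut N) (β : N → N → A) (hl : ∀ x y z, β (x * y) z = β x z + β y z)
    (hr : ∀ x y z, β x (y * z) = β x y + β x z) (hφ : ∀ k x y, β (φ k x) (φ k y) = β x y) :
    TwoCocycle (N ⋊[φ] K) A where
  toFun a b := β a.left (φ a.right b.left)
  cocycle a b c := by
    simp only [SemidirectProduct.mul_left, SemidirectProduct.mul_right, map_mul, hl, hr,
      MulAut.mul_apply, hφ]
    abel

theorem TwoCocycle.symm_of_mem_zpowers {A : Type*} [AddCommGroup A] (f : TwoCocycle G A) {x y : G}
    (h : y ∈ Subgroup.zpowers x) : f x y = f y x := by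
  obtain ⟨n, rfl⟩ := h
  let X : f.Ext := ⟨0, x⟩
  have := Ext.commutator_eq f (Commute.self_zpow x n).eq X (X ^ n) rfl ((Ext.proj f).map_zpow X n)
  rw [(Commute.self_zpow X n).eq] at this
  exact sub_eq_zero.1 (Ext.incl_injective ((mul_eq_right.1 this.symm).trans (map_one _).symm))

/-- If conjugation by `g` fixes `x` modulo `y` and raises `y` to the power `k`, then the
alternating pairing on `x, y` is multiplied by `k`. -/
theorem TwoCocycle.zsmul_sub_eq {A : Type*} [AddCommGroup A] (f : TwoCocycle G A) {x y g : G}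
    (hxy : x * y = y * x) {j k : ℤ} (hx : g * x * g⁻¹ = x * y ^ j) (hy : g * y * g⁻¹ = y ^ k) :
    k • (f x y - f y x) = f x y - f y x := by
  let X : f.Ext := ⟨0, x⟩
  let Y : f.Ext := ⟨0, y⟩
  let T : f.Ext := ⟨0, g⟩
  set w : Multiplicative A := .ofAdd (f x y - f y x) with hw
  have h : X * Y = Ext.incl f w * (Y * X) := Ext.commutator_eq f hxy X Y rfl rfl
  obtain ⟨a, ha⟩ := Ext.exists_eq_incl_mul (x := T * X * T⁻¹) (y := X * Y ^ j) (by
    simp only [map_mul, map_inv, map_zpow]; exact hx)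
  obtain ⟨b, hb⟩ := Ext.exists_eq_incl_mul (x := T * Y * T⁻¹) (y := Y ^ k) (by
    simp only [map_mul, map_inv, map_zpow]; exact hy)
  -- Conjugation by `T` preserves the central commutator `w` of `X` and `Y`; computed from the
  -- conjugates `X * Y ^ j` and `Y ^ k`, up to central factors, it is `w ^ k`.
  have h1 : (T * X * T⁻¹) * (T * Y * T⁻¹) =
      Ext.incl f w * ((T * Y * T⁻¹) * (T * X * T⁻¹)) := by
    have : T * (X * Y) * T⁻¹ = T * (Ext.incl f w * (Y * X)) * T⁻¹ := by rw [h]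
    rw [← mul_assoc T (Ext.incl f w), ← (Ext.incl_commute w T).eq] at this
    calc _ = T * (X * Y) * T⁻¹ := by group
      _ = _ := by rw [this]; group
  have h2 := Ext.zpow_mul_eq h k
  rw [ha, hb] at h1
  have ca : ∀ z, Ext.incl f a * z = z * Ext.incl f a := fun z => Ext.incl_commute a z
  have cb : ∀ z, Ext.incl f b * z = z * Ext.incl f b := fun z => Ext.incl_commute b z
  have cw : ∀ c z, Ext.incl f c * z = z * Ext.incl f c := fun c z => Ext.incl_commute c z
  have h3 : X * Y ^ k = Ext.incl f w * (Y ^ k * X) := by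
    have e1 : Ext.incl f a * (X * Y ^ j) * (Ext.incl f b * Y ^ k) =
        Ext.incl f a * Ext.incl f b * (X * Y ^ k) * Y ^ j := by
      calc _ = Ext.incl f a * ((X * Y ^ j) * Ext.incl f b) * Y ^ k := by group
        _ = Ext.incl f a * (Ext.incl f b * (X * Y ^ j)) * Y ^ k := by rw [cb]
        _ = _ := by simp only [mul_assoc, ← zpow_add, add_comm]
    have e2 : Ext.incl f w * (Ext.incl f b * Y ^ k * (Ext.incl f a * (X * Y ^ j))) =
        Ext.incl f a * Ext.incl f b * (Ext.incl f w * (Y ^ k * X)) * Y ^ j := by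
      calc _ = Ext.incl f w * ((Ext.incl f b * Y ^ k) * Ext.incl f a) * X * Y ^ j := by group
        _ = Ext.incl f w * (Ext.incl f a * (Ext.incl f b * Y ^ k)) * X * Y ^ j := by rw [ca]
        _ = (Ext.incl f w * (Ext.incl f a * Ext.incl f b)) * Y ^ k * X * Y ^ j := by group
        _ = ((Ext.incl f a * Ext.incl f b) * Ext.incl f w) * Y ^ k * X * Y ^ j := by rw [cw w]
        _ = _ := by group
    rw [e1, e2] at h1
    exact mul_left_cancel (mul_right_cancel h1)
  have h4 : w ^ k = w := Ext.incl_injective (mul_right_cancel (h2.symm.trans h3))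
  exact congrArg Multiplicative.toAdd h4

end Cocycles

/-! ### A nonsymmetric cocycle in order 12 -/

section OrderTwelve

theorem exists_twoCocycle_of_card_twelve {B : Type} [Group B] [Finite B] (P : Sylow 2 B)
    [hn : (P : Subgroup B).Normal] (hB : Nat.card B = 12) (hna : ∃ a b : B, a * b ≠ b * a) :
    ∃ f : TwoCocycle B (ZMod 2), ∃ x ∈ P, ∃ y ∈ P, f x y ≠ f y x := by
  have hP : Nat.card P = 2 ^ 2 := P.card_eq_of_card_eq_mul (m := 3) (by rw [hB]; rfl) (by norm_num)
  have hi : (P : Subgroup B).index = 3 := by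
    have := (P : Subgroup B).card_mul_index
    rw [hP, hB] at this
    omega
  have hcomm := (IsPGroup.isMulCommutative_of_card_eq_prime_sq hP).is_comm.comm
  obtain ⟨hcyc, g, hfix⟩ : ¬ IsCyclic P ∧ ∃ g : B, ∀ x ∈ P, g * x * g⁻¹ = x → x = 1 := by
    rcases P.normalizer_le_centralizer_or_of_card_sq hP (fun ℓ hℓ _ => hℓ.two_le) with h | h
    · refine absurd (mul_comm_of_le_center Nat.prime_three hi fun x hx =>
        Subgroup.mem_center_iff.2 fun b => ?_) (by simpa using hna)
      have hT : Subgroup.normalizer ((P : Subgroup B) : Set B) = ⊤ := Subgroup.normalizer_eq_top _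
      exact (h (show b ∈ Subgroup.normalizer ((P : Subgroup B) : Set B) from
        hT ▸ Subgroup.mem_top b) x hx).symm
    · obtain ⟨-, -, hc, g, -, hg⟩ := h
      exact ⟨hc, g, hg⟩
  -- `g ^ 3` lies in `P`, which has index 3, and commutes with `g`.
  have hg3 : g ^ 3 = 1 := hfix _ (hi ▸ (P : Subgroup B).pow_index_mem g) (by group)
  have hg1 : g ≠ 1 := by
    rintro rfl
    have : Subsingleton P := ⟨fun a b => Subtype.ext ((hfix a a.2 (by simp)).trans
      (hfix b b.2 (by simp)).symm)⟩
    have := Nat.card_of_subsingleton (1 : (P : Subgroup B))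
    omega
  let K := Subgroup.zpowers g
  have hK : Nat.card K = 3 := by
    rw [Nat.card_zpowers, orderOf_eq_prime hg3 hg1]
  have hcompl : (P : Subgroup B).IsComplement' K :=
    Subgroup.isComplement'_of_coprime (by rw [hP, hK, hB]; rfl) (by rw [hP, hK]; norm_num)
  let e := SemidirectProduct.mulEquivSubgroup hcompl
  obtain ⟨e0⟩ := isoAdd_prod_of_card_prime_sq hP hcyc
  let χ : P → ZMod 2 := fun x => (e0 x).toAdd.1
  have hχ : ∀ x y, χ (x * y) = χ x + χ y := fun x y => by simp [χ]
  let σ : MulAut P := MulAut.conjNormal g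
  have hσ3 : ∀ x, σ (σ (σ x)) = x := fun x => by
    have : σ ^ 3 = 1 := by rw [← map_pow, hg3, map_one]
    exact MulEquiv.congr_fun this x
  have hσsum : ∀ x, χ x + χ (σ x) + χ (σ (σ x)) = 0 := fun x => by
    have h1 : x * σ x * σ (σ x) = 1 := by
      refine Subtype.ext (hfix _ (x * σ x * σ (σ x)).2 ?_)
      have : σ (x * σ x * σ (σ x)) = x * σ x * σ (σ x) := by
        rw [map_mul, map_mul, hσ3, hcomm, ← mul_assoc]
      exact congrArg Subtype.val this
    have h2 : χ 1 = 0 := by simp [χ]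
    rw [← hχ, ← hχ, h1, h2]
  -- The cyclic sum of `χ(x) χ(σ y)` over the powers of `σ`, hence `σ`-invariant.
  let β : P → P → ZMod 2 := fun x y => χ x * χ (σ y) + χ (σ x) * χ (σ (σ y)) + χ (σ (σ x)) * χ y
  have hβσ : ∀ x y, β (σ x) (σ y) = β x y := fun x y => by
    simp only [β, hσ3]; ring
  obtain ⟨f, hf⟩ : ∃ f : TwoCocycle B (ZMod 2), ∀ x y : P, f x y = β x y := by
    let φ := (P : Subgroup B).normalizerMonoidHom.comp (Subgroup.inclusion
      ((P : Subgroup B).normalizer_eq_top ▸ le_top : K ≤ Subgroup.normalizer (P : Set B)))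
    have hl : ∀ x y z, β (x * y) z = β x z + β y z := fun x y z => by
      simp only [β, map_mul, hχ]; ring
    have hr : ∀ x y z, β x (y * z) = β x y + β x z := fun x y z => by
      simp only [β, map_mul, hχ]; ring
    have hφ : ∀ k x y, β (φ k x) (φ k y) = β x y := by
      rintro ⟨_, i, rfl⟩ x y
      let S : Subgroup (MulAut P) :=
        { carrier := {τ | ∀ x y, β (τ x) (τ y) = β x y}
          mul_mem' := fun {a b} ha hb x y => (ha (b x) (b y)).trans (hb x y)
          one_mem' := fun x y => rfl
          inv_mem' := fun {a} ha x y => by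
            rw [← ha]; simp }
      have h1 : σ ^ i ∈ S := S.zpow_mem hβσ i
      have h2 : ∀ z : P, φ (⟨g ^ i, i, rfl⟩ : K) z = (σ ^ i) z := fun z => by
        rw [show σ ^ i = MulAut.conjNormal (g ^ i) from (map_zpow _ _ _).symm]
        rfl
      exact (congrArg₂ β (h2 x) (h2 y)).trans (h1 x y)
    refine ⟨(TwoCocycle.ofSemidirect φ β hl hr hφ).comap e.symm.toMonoidHom, fun x y => ?_⟩
    have hs : ∀ z : P, e.symm z = SemidirectProduct.inl z := fun z => by
      rw [MulEquiv.symm_apply_eq]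
      show (z : B) = (z : B) * ((1 : K) : B)
      rw [Subgroup.coe_one, mul_one]
    refine (congrArg₂ (TwoCocycle.ofSemidirect φ β hl hr hφ).toFun (hs x) (hs y)).trans ?_
    simp only [TwoCocycle.ofSemidirect, SemidirectProduct.left_inl, SemidirectProduct.right_inl,
      map_one, MulAut.one_apply]
  obtain ⟨a, ha⟩ : ∃ a : P, χ a = 1 := ⟨e0.symm (.ofAdd (1, 0)), by simp [χ]⟩
  refine ⟨f, a, a.2, σ a, (σ a).2, ?_⟩
  rw [hf, hf]
  have h := hσsum a
  simp only [β, hσ3]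
  rw [ha] at h ⊢
  -- From `1 + s + t = 0` exactly one of `s, t` is 1, so `β a (σ a) = s + t + s * t = 1` while `β (σ
  -- a) a = s² + t² + 1 = 0`.
  generalize χ (σ a) = s at *
  generalize χ (σ (σ a)) = t at *
  revert s t
  decide

end OrderTwelve

/-! ### Nontrivial multipliers: Burnside's case and quotients of order 12 -/

section

variable {G : Type} [Group G]

theorem TwoCocycle.symm_of_isCyclic {A : Type*} [AddCommGroup A] (f : TwoCocycle G A)
    (H : Subgroup G) [IsCyclic H] {x y : G} (hx : x ∈ H) (hy : y ∈ H) : f x y = f y x := by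
  obtain ⟨z, hz⟩ := IsCyclic.exists_generator (α := H)
  have h := f.comm_of_generators (x := (z : G)) (y := z) (H := H) rfl rfl (fun g hg => by
    obtain ⟨i, hi⟩ := hz ⟨g, hg⟩
    exact ⟨i, 0, by simpa using (congrArg Subtype.val hi).symm⟩) ⟨0, x⟩ ⟨0, y⟩ hx hy
  simpa [Ext.mul_def] using congrArg Ext.fst h

variable [Finite G]

/-- On `P` the transfer `G → P` is a power map with exponent prime to `p`, hence bijective. So `P`
is a quotient of the abelianization, and a noncyclic `P` carries two coordinate homomorphisms to
`ZMod p` whose cup product is not symmetric. -/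
theorem schur_of_normalizer_le_centralizer {p : ℕ} [hp : Fact p.Prime] (P : Sylow p G)
    (hP : Nat.card P = p ^ 2)
    (hN : Subgroup.normalizer P ≤ Subgroup.centralizer (P : Set G))
    (hG : ∀ ℓ : ℕ, ℓ.Prime → ℓ ≠ p → ∀ Q : Sylow ℓ G, IsCyclic Q) :
    (IsCyclic (Abelianization G) → SchurIsZero G) ∧
      (¬ IsCyclic (Abelianization G) → SchurIsZMod G p) := by
  have hcomm := (IsPGroup.isMulCommutative_of_card_eq_prime_sq hP).is_comm.comm
  let τ : G →* P := MonoidHom.transferSylow P hN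
  have hτ : Function.Bijective fun x : P => τ x := by
    have h : Function.Bijective fun x : P => x ^ (P : Subgroup G).index :=
      (P.2.powEquiv' P.not_dvd_index).bijective
    rw [← MonoidHom.transferSylow_domRestrict_eq_pow P hN] at h
    exact h
  by_cases hc : IsCyclic P
  · have := isZGroup_of_isCyclic_sylow P hc hG
    exact ⟨fun _ => schurIsZero_of_isZGroup, fun h => absurd IsZGroup.isCyclic_abelianization h⟩
  · refine ⟨fun h => absurd ?_ hc, fun _ => ?_⟩
    · have hle : commutator G ≤ τ.ker := Subgroup.commutator_le.2 fun a _ b _ => by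
        rw [MonoidHom.mem_ker, map_commutatorElement, commutatorElement_eq_one_iff_mul_comm, hcomm]
      have h' : IsCyclic (G ⧸ commutator G) := h
      let f : G ⧸ commutator G →* P := QuotientGroup.lift (commutator G) τ hle
      have hf : Function.Surjective f := fun y => by
        obtain ⟨x, hx⟩ := hτ.2 y
        exact ⟨QuotientGroup.mk (x : G), hx⟩
      exact isCyclic_of_surjective f hf
    · obtain ⟨e⟩ := isoAdd_prod_of_card_prime_sq hP hc
      let π : G →* Multiplicative (ZMod p × ZMod p) := e.toMonoidHom.comp τ
      have hπ : Function.Bijective fun x : P => π x := e.bijective.comp hτ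
      obtain ⟨x, hx⟩ := hπ.2 (.ofAdd (1, 0))
      obtain ⟨y, hy⟩ := hπ.2 (.ofAdd (0, 1))
      let u : G →* Multiplicative (ZMod p) := (AddMonoidHom.toMultiplicative (AddMonoidHom.fst _ _)).comp π
      let v : G →* Multiplicative (ZMod p) := (AddMonoidHom.toMultiplicative (AddMonoidHom.snd _ _)).comp π
      have hf : TwoCocycle.cup u v x y ≠ TwoCocycle.cup u v y x := by
        have hx' : π x = .ofAdd (1, 0) := hx
        have hy' : π y = .ofAdd (0, 1) := hy
        simp [TwoCocycle.cup, u, v, hx', hy']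
      refine (schur_of_sylow P hG (congrArg Subtype.val (hcomm x y)) (fun g hg => ?_)
        (congrArg Subtype.val (pow_eq_one_of_card_prime_sq hP hc y))).2.2 _ hf
      have hx1 : x ≠ 1 := by
        rintro rfl
        exact hf (TwoCocycle.symm_of_mem_zpowers _ (one_mem _)).symm
      have hy1 : y ∉ Subgroup.zpowers x := by
        rintro ⟨n, rfl⟩
        exact hf (TwoCocycle.symm_of_mem_zpowers _ ⟨n, rfl⟩)
      obtain ⟨i, j, h⟩ := exists_zpow_mul_zpow_of_card_prime_sq hP hx1 hy1 ⟨g, hg⟩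
      exact ⟨i, j, congrArg Subtype.val h⟩

/-- `P` maps onto `Q`, so the nonsymmetric pair for `B` lifts to `P` and inflation keeps the
asymmetry; this also shows that `P` is not cyclic. -/
theorem schurIsZMod_two_of_surjective (P : Sylow 2 G) (hP : Nat.card P = 2 ^ 2)
    (hG : ∀ ℓ : ℕ, ℓ.Prime → ℓ ≠ 2 → ∀ Q : Sylow ℓ G, IsCyclic Q)
    {B : Type} [Group B] [Finite B] (π : G →* B) (hπ : Function.Surjective π) (Q : Sylow 2 B)
    [(Q : Subgroup B).Normal] (hB : Nat.card B = 12) (hna : ∃ a b : B, a * b ≠ b * a) :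
    SchurIsZMod G 2 := by
  obtain ⟨f, x', hx', y', hy', hf⟩ := exists_twoCocycle_of_card_twelve Q hB hna
  have hQ : (P : Subgroup G).map π = Q := by
    have := Sylow.unique_of_normal Q inferInstance
    exact congrArg Sylow.toSubgroup (Subsingleton.elim (P.mapSurjective hπ) Q)
  obtain ⟨x, hx, rfl⟩ : x' ∈ (P : Subgroup G).map π := hQ ▸ hx'
  obtain ⟨y, hy, rfl⟩ : y' ∈ (P : Subgroup G).map π := hQ ▸ hy'
  have hf' : f.comap π x y ≠ f.comap π y x := hf
  have hcomm := (IsPGroup.isMulCommutative_of_card_eq_prime_sq hP).is_comm.comm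
  have hy1 : y ∉ Subgroup.zpowers x := fun h => hf' (TwoCocycle.symm_of_mem_zpowers _ h)
  have hx1 : x ≠ 1 := by
    rintro rfl
    exact hf' (TwoCocycle.symm_of_mem_zpowers _ (one_mem _)).symm
  have hc : ¬ IsCyclic P := by
    intro hc
    exact hf' ((f.comap π).symm_of_isCyclic P hx hy)
  have hcP : x * y = y * x := congrArg Subtype.val (hcomm ⟨x, hx⟩ ⟨y, hy⟩)
  refine (schur_of_sylow P hG hcP (fun g hg => ?_) (congrArg Subtype.val
    (pow_eq_one_of_card_prime_sq hP hc ⟨y, hy⟩))).2.2 _ hf'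
  obtain ⟨i, j, h⟩ := exists_zpow_mul_zpow_of_card_prime_sq hP (x := ⟨x, hx⟩) (y := ⟨y, hy⟩)
    (fun h => hx1 (congrArg Subtype.val h)) (by
      rintro ⟨n, hn⟩
      exact hy1 ⟨n, congrArg Subtype.val hn⟩) ⟨g, hg⟩
  exact ⟨i, j, congrArg Subtype.val h⟩

end

/-! ### Order `pq²` -/

section

variable {G : Type} [Group G] [Finite G]

/-- Conjugating `x` by `g ^ p` gives `x * y ^ (j * p)`, so the order of `y ^ j` divides both `p` and
`q`. -/
theorem commute_of_conj_eq_mul_zpow {H : Type*} [Group H] {g x y : H} {j : ℤ} {p q : ℕ}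
    (hpq : Nat.Coprime p q) (hx : g * x * g⁻¹ = x * y ^ j) (hgy : g * y = y * g)
    (hy : y ^ q = 1) (hg : g ^ p * x = x * g ^ p) : g * x = x * g := by
  have key : ∀ n : ℕ, g ^ n * x * (g ^ n)⁻¹ = x * y ^ (j * n) := fun n => by
    induction n with
    | zero => simp
    | succ n ih =>
      have h1 : g * y ^ (j * n) * g⁻¹ = y ^ (j * n) := by
        rw [(Commute.zpow_right hgy _ : g * y ^ (j * n) = _), mul_inv_cancel_right]
      calc g ^ (n + 1) * x * (g ^ (n + 1))⁻¹ = g * (g ^ n * x * (g ^ n)⁻¹) * g⁻¹ := by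
            rw [pow_succ']; group
        _ = (g * x * g⁻¹) * (g * y ^ (j * n) * g⁻¹) := by rw [ih]; group
        _ = x * y ^ (j * (n + 1 : ℕ)) := by
            rw [hx, h1, mul_assoc, ← zpow_add]; congr 2; push_cast; ring
  have h2 : y ^ (j * p) = 1 := by
    have := key p
    rw [hg, mul_inv_cancel_right] at this
    exact (mul_eq_left.1 this.symm)
  have h3 : y ^ j = 1 := by
    rw [← orderOf_dvd_iff_zpow_eq_one] at h2 ⊢
    exact IsCoprime.dvd_of_dvd_mul_right (Nat.isCoprime_iff_coprime.2
      (hpq.symm.coprime_dvd_left (orderOf_dvd_of_pow_eq_one hy))) h2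
  rw [h3, mul_one] at hx
  exact mul_inv_eq_iff_eq_mul.1 hx

theorem schur_prime_mul_sq (hG : ∃ a b : G, a * b ≠ b * a) {p q : ℕ} (hp : p.Prime) (hq : q.Prime)
    (hpq : p < q) (hc : Nat.card G = p * q ^ 2) :
    (IsoAdd (commutator G) (ZMod q) ∨ IsoAdd (commutator G) (ZMod (q ^ 2)) ∨
        IsoAdd (commutator G) (ZMod q × ZMod q)) ∧
      (IsoAdd (commutator G) (ZMod q) → SchurIsZero G) ∧
      (IsoAdd (commutator G) (ZMod (q ^ 2)) → SchurIsZero G) ∧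
      (IsoAdd (commutator G) (ZMod q × ZMod q) → SchurIsZero G ∨ SchurIsZMod G q) := by
  have : Fact p.Prime := ⟨hp⟩
  have : Fact q.Prime := ⟨hq⟩
  have hcop : Nat.Coprime p q := (Nat.coprime_primes hp hq).2 hpq.ne
  have hqp : ¬ q ∣ p := Nat.not_dvd_of_pos_of_lt hp.pos hpq
  obtain ⟨Q⟩ : Nonempty (Sylow q G) := inferInstance
  have hQ : Nat.card Q = q ^ 2 := Q.card_eq_of_card_eq_mul (m := p) (by rw [hc, mul_comm]) hqp
  have hi : (Q : Subgroup G).index = p := by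
    have := (Q : Subgroup G).card_mul_index
    rw [hQ, hc, mul_comm] at this
    exact Nat.eq_of_mul_eq_mul_right (pow_pos hq.pos 2) this
  have hn : (Q : Subgroup G).Normal := by
    refine Subgroup.normal_of_index_eq_minFac_card ?_
    rw [hi, hc]
    refine le_antisymm ?_ (Nat.minFac_le_of_dvd hp.two_le (dvd_mul_right _ _))
    have h1 : p * q ^ 2 ≠ 1 := fun h => hp.one_lt.ne' (Nat.eq_one_of_mul_eq_one_right h)
    rcases (Nat.minFac_prime h1).dvd_mul.1 (Nat.minFac_dvd _) with h | h
    · exact ((Nat.prime_dvd_prime_iff_eq (Nat.minFac_prime h1) hp).1 h).ge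
    · exact hpq.le.trans ((Nat.prime_dvd_prime_iff_eq (Nat.minFac_prime h1) hq).1
        ((Nat.minFac_prime h1).dvd_of_dvd_pow h)).ge
  have hcycp : ∀ ℓ : ℕ, ℓ.Prime → ℓ ≠ q → ∀ R : Sylow ℓ G, IsCyclic R := fun ℓ hℓ hne R => by
    have : Fact ℓ.Prime := ⟨hℓ⟩
    refine R.isCyclic_of_card_eq_mul (a := q ^ 2) (m := p) (by rw [hc, mul_comm]) (fun h => hne ?_)
      hp.squarefree
    exact (Nat.prime_dvd_prime_iff_eq hℓ hq).1 (hℓ.dvd_of_dvd_pow h)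
  have hle : commutator G ≤ Q := commutator_le_of_index_prime hp hi
  have hcomm := (IsPGroup.isMulCommutative_of_card_eq_prime_sq hQ).is_comm.comm
  have hz : IsCyclic Q → SchurIsZero G := fun h => by
    have := isZGroup_of_isCyclic_sylow Q h hcycp
    exact schurIsZero_of_isZGroup
  refine ⟨?_, fun ⟨e⟩ => ?_, fun ⟨e⟩ => ?_, fun ⟨e⟩ => ?_⟩
  · obtain ⟨k, hk, ho⟩ := (Nat.dvd_prime_pow hq).1 (hQ ▸ Subgroup.card_dvd_of_le hle)
    have hk0 : k ≠ 0 := by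
      rintro rfl
      exact commutator_ne_bot hG (Subgroup.card_eq_one.1 ho)
    obtain rfl | rfl : k = 1 ∨ k = 2 := by omega
    · rw [pow_one] at ho
      exact Or.inl (isoAdd_zmod_of_isCyclic (isCyclic_of_prime_card ho) ho)
    · by_cases h : IsCyclic (commutator G)
      · exact Or.inr (Or.inl (isoAdd_zmod_of_isCyclic h ho))
      · exact Or.inr (Or.inr (isoAdd_prod_of_card_prime_sq ho h))
  · by_cases hcyc : IsCyclic Q
    · exact hz hcyc
    have hG' : Nat.card (commutator G) = q := by
      rw [IsoAdd.card_eq ⟨e⟩, Nat.card_zmod]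
    have : IsCyclic (commutator G) := isCyclic_of_prime_card hG'
    obtain ⟨⟨y, hyG⟩, hgen⟩ := IsCyclic.exists_generator (α := commutator G)
    have hpow : ∀ z ∈ commutator G, ∃ k : ℤ, z = y ^ k := fun z hz => by
      obtain ⟨k, hk⟩ := hgen ⟨z, hz⟩
      exact ⟨k, (congrArg Subtype.val hk).symm⟩
    have hyQ : y ∈ Q := hle hyG
    have hyq : y ^ q = 1 := congrArg Subtype.val (pow_eq_one_of_card_prime_sq hQ hcyc ⟨y, hyQ⟩)
    -- With `y` generating the commutator subgroup, every conjugate of `x` is `x` times a power of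
    -- `y`.
    obtain ⟨x, hxQ, hxG⟩ : ∃ x ∈ Q, x ∉ commutator G := by
      by_contra! h
      have := Subgroup.card_le_of_le (show (Q : Subgroup G) ≤ commutator G from h)
      rw [hQ, hG'] at this
      nlinarith [hq.one_lt]
    have hxy : x * y = y * x := congrArg Subtype.val (hcomm ⟨x, hxQ⟩ ⟨y, hyQ⟩)
    have hspan : ∀ g ∈ Q, ∃ i j : ℤ, g = x ^ i * y ^ j := fun g hg => by
      obtain ⟨i, j, h⟩ := exists_zpow_mul_zpow_of_card_prime_sq hQ (x := ⟨y, hyQ⟩) (y := ⟨x, hxQ⟩)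
        (by
          intro h
          obtain rfl : y = 1 := congrArg Subtype.val h
          refine commutator_ne_bot hG ((Subgroup.eq_bot_iff_forall _).2 fun z hz => ?_)
          obtain ⟨k, rfl⟩ := hpow z hz
          exact one_zpow k) (by
          rintro ⟨n, hn⟩
          have h1 : y ^ n = x := congrArg Subtype.val hn
          exact hxG (h1 ▸ (commutator G).zpow_mem hyG n))
        ⟨g, hg⟩
      refine ⟨j, i, (congrArg Subtype.val h).trans ?_⟩
      exact ((Commute.zpow_zpow hxy j i).eq).symm
    refine (schur_of_sylow Q hcycp hxy hspan hyq).1 fun f => ?_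
    have hconj : ∀ g : G, ∃ j k : ℤ, g * x * g⁻¹ = x * y ^ j ∧ g * y * g⁻¹ = y ^ k := fun g => by
      obtain ⟨j, hj⟩ := hpow (x⁻¹ * (g * x * g⁻¹)) (by
        have := Subgroup.commutator_mem_commutator (Subgroup.mem_top x⁻¹) (Subgroup.mem_top g)
        rwa [commutatorElement_def, inv_inv, mul_assoc, mul_assoc, ← mul_assoc g] at this)
      obtain ⟨k, hk⟩ := hpow (g * y * g⁻¹) (Subgroup.Normal.conj_mem inferInstance y hyG g)
      exact ⟨j, k, by rw [← hj, mul_inv_cancel_left], hk⟩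
    have hω : ((q : ℕ) : ℤ) • (f x y - f y x) = 0 := by
      rw [natCast_zsmul, f.nsmul_sub_eq_zero hxy hyq]
    -- If `y` is central, then so is `x`, hence `Q`, and `G` would be abelian. Otherwise some `g`
    -- raises `y` to a power `k ≢ 1` mod `q`, so the pairing is killed by both `k - 1` and `q`.
    by_cases hyc : ∀ g : G, g * y = y * g
    · exfalso
      obtain ⟨a, b, hab⟩ := hG
      refine hab (mul_comm_of_le_center hp hi (fun z hz => Subgroup.mem_center_iff.2 fun g => ?_)
        a b)
      obtain ⟨j, k, hj, -⟩ := hconj g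
      have hgx : Commute g x := commute_of_conj_eq_mul_zpow hcop hj (hyc g) hyq (by
        have := hcomm ⟨g ^ p, hi ▸ (Q : Subgroup G).pow_index_mem g⟩ ⟨x, hxQ⟩
        exact congrArg Subtype.val this)
      obtain ⟨m, n, rfl⟩ := hspan z hz
      exact (hgx.zpow_right m).mul_right (Commute.zpow_right (hyc g) n)
    · push Not at hyc
      obtain ⟨g, hg⟩ := hyc
      obtain ⟨j, k, hj, hk⟩ := hconj g
      have h1 := f.zsmul_sub_eq hxy hj hk
      have hk1 : ¬ (q : ℤ) ∣ k - 1 := fun ⟨m, hm⟩ => hg (by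
        rw [← mul_inv_eq_iff_eq_mul, hk, show k = q * m + 1 by linarith, zpow_add, zpow_mul,
          zpow_natCast, hyq, one_zpow, one_mul, zpow_one])
      obtain ⟨a, b, hab⟩ := (Prime.coprime_iff_not_dvd (Nat.prime_iff_prime_int.1 hq)).2 hk1
      rw [← sub_eq_zero, ← one_smul ℤ (f x y - f y x), ← hab, add_smul, mul_smul, mul_smul, hω,
        sub_smul, h1]
      simp
  · have ho : Nat.card (commutator G) = q ^ 2 := by rw [IsoAdd.card_eq ⟨e⟩, Nat.card_zmod]
    have hcG : IsCyclic (commutator G) := by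
      have : IsCyclic (Multiplicative (ZMod (q ^ 2))) := inferInstance
      exact isCyclic_of_surjective e.symm e.symm.surjective
    exact hz (by
      rwa [show commutator G = Q from Subgroup.eq_of_le_of_card_ge hle (by rw [hQ, ho])] at hcG)
  · by_cases hcyc : IsCyclic Q
    · exact Or.inl (hz hcyc)
    have : Nontrivial Q := by
      by_contra h
      rw [not_nontrivial_iff_subsingleton] at h
      exact hcyc inferInstance
    obtain ⟨x, hx⟩ := exists_ne (1 : Q)
    obtain ⟨y, hy⟩ : ∃ y, y ∉ Subgroup.zpowers x := by
      by_contra! h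
      exact hcyc ⟨x, h⟩
    refine (schur_of_sylow Q hcycp (congrArg Subtype.val (hcomm x y)) (fun g hg => ?_)
      (congrArg Subtype.val (pow_eq_one_of_card_prime_sq hQ hcyc y))).2.1
    obtain ⟨i, j, h⟩ := exists_zpow_mul_zpow_of_card_prime_sq hQ hx hy ⟨g, hg⟩
    exact ⟨i, j, congrArg Subtype.val h⟩

end

/-! ### Orders `p²q` and `p²qr` with `pq ≠ 6` -/

section

variable {G : Type} [Group G]

theorem Sylow.twelve_dvd_card_normalizer (P : Sylow 2 G) (hP : Nat.card P = 2 ^ 2)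
    (h3 : 3 ∣ Nat.card (Subgroup.normalizer (P : Set G))) :
    12 ∣ Nat.card (Subgroup.normalizer (P : Set G)) := by
  have h4 : 4 ∣ Nat.card (Subgroup.normalizer (P : Set G)) := by
    have : Nat.card P ∣ _ := Subgroup.card_dvd_of_le (Subgroup.le_normalizer (H := (P : Subgroup G)))
    rwa [hP] at this
  exact Nat.Coprime.mul_dvd_of_dvd_of_dvd (by norm_num : Nat.Coprime 4 3) h4 h3

variable [Finite G]

theorem Sylow.isCyclic_of_card_eq_sq_mul {p m : ℕ} (hp : p.Prime) (hc : Nat.card G = p ^ 2 * m)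
    (hm : Squarefree m) (ℓ : ℕ) (hℓ : ℓ.Prime) (hne : ℓ ≠ p) (Q : Sylow ℓ G) : IsCyclic Q := by
  have : Fact ℓ.Prime := ⟨hℓ⟩
  exact Q.isCyclic_of_card_eq_mul hc (fun h => hne ((Nat.prime_dvd_prime_iff_eq hℓ hp).1
    (hℓ.dvd_of_dvd_pow h))) hm

theorem schur_sq_mul_prime (hG : ∃ a b : G, a * b ≠ b * a) {p q : ℕ} (hp : p.Prime) (hq : q.Prime)
    (hpq : p < q) (hc : Nat.card G = p ^ 2 * q) :
    ((IsoAdd (commutator G) (ZMod q) ∧ IsoAdd (Abelianization G) (ZMod (p ^ 2))) ∨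
        (IsoAdd (commutator G) (ZMod q) ∧ IsoAdd (Abelianization G) (ZMod p × ZMod p)) ∨
        IsoAdd (commutator G) (ZMod 2 × ZMod 2)) ∧
      (IsoAdd (commutator G) (ZMod q) → IsoAdd (Abelianization G) (ZMod (p ^ 2)) →
        SchurIsZero G) ∧
      (IsoAdd (commutator G) (ZMod q) → IsoAdd (Abelianization G) (ZMod p × ZMod p) →
        SchurIsZMod G p) ∧
      (IsoAdd (commutator G) (ZMod 2 × ZMod 2) → SchurIsZMod G 2) := by
  have : Fact p.Prime := ⟨hp⟩
  have : Fact q.Prime := ⟨hq⟩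
  have hpq' : ¬ p ∣ q := fun h => hpq.ne ((Nat.prime_dvd_prime_iff_eq hp hq).1 h)
  obtain ⟨P⟩ : Nonempty (Sylow p G) := inferInstance
  have hP : Nat.card P = p ^ 2 := P.card_eq_of_card_eq_mul hc hpq'
  have hi : (P : Subgroup G).index = q := by
    have := (P : Subgroup G).card_mul_index
    rw [hP, hc] at this
    exact Nat.eq_of_mul_eq_mul_left (pow_pos hp.pos 2) this
  have hcyc := Sylow.isCyclic_of_card_eq_sq_mul hp hc hq.squarefree
  have hcomm := (IsPGroup.isMulCommutative_of_card_eq_prime_sq hP).is_comm.comm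
  have hmin : ∀ ℓ : ℕ, ℓ.Prime → ℓ ∣ Nat.card G → p ≤ ℓ := fun ℓ hℓ h => by
    rw [hc] at h
    rcases hℓ.dvd_mul.1 h with h | h
    · exact ((Nat.prime_dvd_prime_iff_eq hℓ hp).1 (hℓ.dvd_of_dvd_pow h)).ge
    · exact ((Nat.prime_dvd_prime_iff_eq hℓ hq).1 h) ▸ hpq.le
  rcases P.normalizer_le_centralizer_or_of_card_sq hP hmin with hN | ⟨h2, h3, hnc, g, hg, hfix⟩
  -- The kernel of the transfer has order `q` and contains the nontrivial commutator subgroup, so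
  -- the two coincide in order.
  · have hker := MonoidHom.ker_transferSylow_isComplement' P hN
    have hle : commutator G ≤ (MonoidHom.transferSylow P hN).ker :=
      Subgroup.commutator_le.2 fun a _ b _ => by
        rw [MonoidHom.mem_ker, map_commutatorElement, commutatorElement_eq_one_iff_mul_comm, hcomm]
    have hkc : Nat.card (MonoidHom.transferSylow P hN).ker = q := by
      rw [← hker.index_eq_card, hi]
    have hG'q : Nat.card (commutator G) = q :=
      ((Nat.dvd_prime hq).1 (hkc ▸ Subgroup.card_dvd_of_le hle)).resolve_left fun h =>
        commutator_ne_bot hG (Subgroup.card_eq_one.1 h)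
    have hab : Nat.card (Abelianization G) = p ^ 2 := by
      have h := (commutator G).card_mul_index
      rw [hG'q, hc, mul_comm] at h
      exact Nat.eq_of_mul_eq_mul_right hq.pos h
    have hiso : IsoAdd (commutator G) (ZMod q) :=
      isoAdd_zmod_of_isCyclic (isCyclic_of_prime_card hG'q) hG'q
    have hM := schur_of_normalizer_le_centralizer P hP hN hcyc
    refine ⟨?_, fun _ ⟨e⟩ => hM.1 (isCyclic_of_surjective e.symm e.symm.surjective),
      fun _ ⟨e⟩ => hM.2 fun h => ?_, fun h => ?_⟩
    · by_cases h : IsCyclic (Abelianization G)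
      · exact Or.inl ⟨hiso, isoAdd_zmod_of_isCyclic h hab⟩
      · exact Or.inr (Or.inl ⟨hiso, isoAdd_prod_of_card_prime_sq hab h⟩)
    · have h1 : IsCyclic (Multiplicative (ZMod p × ZMod p)) :=
        isCyclic_of_surjective e e.surjective
      have h2 := h1.exponent_eq_card
      rw [Nat.card_congr Multiplicative.toAdd, Nat.card_prod, Nat.card_zmod] at h2
      have h3 : Monoid.exponent (Multiplicative (ZMod p × ZMod p)) ∣ p :=
        Monoid.exponent_dvd_of_forall_pow_eq_one fun x => by
          apply Multiplicative.toAdd.injective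
          ext <;> simp
      rw [h2] at h3
      exact absurd (Nat.le_of_dvd hp.pos h3) (by nlinarith [hp.one_lt])
    · have := h.card_eq
      rw [hG'q, Nat.card_prod, Nat.card_zmod] at this
      subst this
      exact absurd hq (by norm_num)
  · subst h2
    have h12 := (P.twelve_dvd_card_normalizer hP h3)
    obtain rfl : q = 3 := by
      have h : 3 ∣ 2 ^ 2 * q := hc ▸ h3.trans (Subgroup.card_subgroup_dvd_card _)
      exact ((Nat.prime_dvd_prime_iff_eq Nat.prime_three hq).1
        ((Nat.Coprime.dvd_mul_left (by norm_num)).1 h)).symm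
    have hn : (P : Subgroup G).Normal := Subgroup.normalizer_eq_top_iff.1
      (Subgroup.eq_top_of_le_card _ (by rw [hc]; exact Nat.le_of_dvd Nat.card_pos h12))
    -- `P` is now normal of index 3, which bounds the commutator subgroup above;
    -- fixed-point-freeness bounds it below.
    have hPG : (P : Subgroup G) = commutator G := le_antisymm
      (le_commutator_of_fixedPointFree (fun x hx y hy => congrArg Subtype.val
        (hcomm ⟨x, hx⟩ ⟨y, hy⟩)) hg hfix)
      (commutator_le_of_index_prime hq hi)
    have hcard : Nat.card (commutator G) = 4 := by rw [← hPG, hP]; rfl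
    have hnot : ¬ IsoAdd (commutator G) (ZMod 3) := fun h => by
      have := h.card_eq
      rw [hcard, Nat.card_zmod] at this
      omega
    have hZ : SchurIsZMod G 2 := schurIsZMod_two_of_surjective P hP hcyc (MonoidHom.id G)
      Function.surjective_id P (by rw [hc]; rfl) hG
    exact ⟨Or.inr (Or.inr (hPG ▸ isoAdd_prod_of_card_prime_sq hP hnc)),
      fun h => absurd h hnot, fun h => absurd h hnot, fun _ => hZ⟩

theorem schur_sq_mul_mul (p q r : ℕ) (hp : p.Prime) (hq : q.Prime) (hr : r.Prime) (hpq : p < q)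
    (hqr : q < r) (hc : Nat.card G = p ^ 2 * q * r) (h6 : p * q ≠ 6) :
    (IsCyclic (Abelianization G) → SchurIsZero G) ∧
      (¬ IsCyclic (Abelianization G) → SchurIsZMod G p) := by
  have : Fact p.Prime := ⟨hp⟩
  have hpq' : ¬ p ∣ q := fun h => hpq.ne ((Nat.prime_dvd_prime_iff_eq hp hq).1 h)
  have hpr' : ¬ p ∣ r := fun h => (hpq.trans hqr).ne ((Nat.prime_dvd_prime_iff_eq hp hr).1 h)
  have hqr' : Nat.Coprime q r := (Nat.coprime_primes hq hr).2 hqr.ne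
  rw [mul_assoc] at hc
  obtain ⟨P⟩ : Nonempty (Sylow p G) := inferInstance
  have hP : Nat.card P = p ^ 2 := P.card_eq_of_card_eq_mul hc (hp.not_dvd_mul hpq' hpr')
  have hcyc := Sylow.isCyclic_of_card_eq_sq_mul hp hc
    ((Nat.squarefree_mul hqr').2 ⟨hq.squarefree, hr.squarefree⟩)
  have hmem : ∀ ℓ : ℕ, ℓ.Prime → ℓ ∣ Nat.card G → ℓ = p ∨ ℓ = q ∨ ℓ = r := fun ℓ hℓ h => by
    rw [hc] at h
    rcases hℓ.dvd_mul.1 h with h | h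
    · exact Or.inl ((Nat.prime_dvd_prime_iff_eq hℓ hp).1 (hℓ.dvd_of_dvd_pow h))
    · exact Or.inr ((hℓ.dvd_mul.1 h).imp (Nat.prime_dvd_prime_iff_eq hℓ hq).1
        (Nat.prime_dvd_prime_iff_eq hℓ hr).1)
  rcases P.normalizer_le_centralizer_or_of_card_sq hP (fun ℓ hℓ h => by
    have := hmem ℓ hℓ h
    omega) with hN | ⟨h2, h3, -⟩
  · exact schur_of_normalizer_le_centralizer P hP hN hcyc
  · have := hmem 3 Nat.prime_three (h3.trans (Subgroup.card_subgroup_dvd_card _))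
    exfalso
    apply h6
    obtain rfl : q = 3 := by omega
    rw [h2]

end

/-! ### Order `12r` -/

section

variable {G : Type} [Group G] [Finite G]

/-- If the commutator subgroup has prime index `r` and contains a normal subgroup with abelian
quotient of order less than `r`, then it equals that subgroup. -/
theorem commutator_le_of_index_map_lt {T : Subgroup G} [T.Normal] {r : ℕ} (hr : r.Prime)
    (hT : T ≤ commutator G) (hi : (commutator G).index = r)
    (hcomm : ∀ x ∈ (commutator G).map (QuotientGroup.mk' T),
      ∀ y ∈ (commutator G).map (QuotientGroup.mk' T), x * y = y * x)
    (hlt : Nat.card ((commutator G).map (QuotientGroup.mk' T)) < r) : commutator G ≤ T := by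
  have hn : ((commutator G).map (QuotientGroup.mk' T)).Normal :=
    Subgroup.Normal.map inferInstance _ (QuotientGroup.mk'_surjective T)
  refine commutator_le_of_comm (mul_comm_of_card_lt_index hr ?_ hcomm hlt)
  rw [Subgroup.index_map_eq _ (QuotientGroup.mk'_surjective T) (by rwa [QuotientGroup.ker_mk']), hi]

theorem schur_twelve_mul_of_card_commutator {r : ℕ} (hr : r.Prime) (h3r : 3 < r)
    (hc : Nat.card G = 12 * r)
    (h : Nat.card (commutator G) = 4 ∨ Nat.card (commutator G) = 4 * r) : SchurIsZMod G 2 := by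
  have : Fact r.Prime := ⟨hr⟩
  have hr5 : 5 ≤ r := by
    rcases Nat.lt_or_ge r 5 with h | h
    · obtain rfl : r = 4 := by omega
      exact absurd hr (by norm_num)
    · exact h
  have h2r : ¬ 2 ∣ r := fun h => by have := (Nat.prime_dvd_prime_iff_eq Nat.prime_two hr).1 h; omega
  have hr4 : ¬ r ∣ 4 := Nat.not_dvd_of_pos_of_lt (by norm_num) (by omega)
  have hr3 : ¬ r ∣ 3 := Nat.not_dvd_of_pos_of_lt (by norm_num) (by omega)
  have hc' : Nat.card G = 2 ^ 2 * (3 * r) := by rw [hc]; ring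
  obtain ⟨P⟩ : Nonempty (Sylow 2 G) := inferInstance
  have hP : Nat.card P = 2 ^ 2 :=
    P.card_eq_of_card_eq_mul hc' (Nat.prime_two.not_dvd_mul (by norm_num) h2r)
  have hcyc := Sylow.isCyclic_of_card_eq_sq_mul Nat.prime_two hc'
    ((Nat.squarefree_mul ((Nat.coprime_primes Nat.prime_three hr).2 h3r.ne)).2
      ⟨Nat.prime_three.squarefree, hr.squarefree⟩)
  -- If the commutator subgroup has order 4, the abelianization has order `3r` and `K` is the
  -- preimage of its Sylow `r`-subgroup.
  obtain ⟨K, hKn, hK⟩ : ∃ K : Subgroup G, K.Normal ∧ Nat.card K = 4 * r := by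
    rcases h with h | h
    · obtain ⟨S⟩ : Nonempty (Sylow r (Abelianization G)) := inferInstance
      have hab : Nat.card (Abelianization G) = r ^ 1 * 3 := by
        have h1 : _ * Nat.card (Abelianization G) = _ := (commutator G).card_mul_index
        rw [h, hc] at h1
        rw [pow_one]
        omega
      have hS : Nat.card S = r ^ 1 := S.card_eq_of_card_eq_mul hab hr3
      have hSi : (S : Subgroup (Abelianization G)).index = 3 := by
        have := (S : Subgroup (Abelianization G)).card_mul_index
        rw [hS, hab] at this
        exact Nat.eq_of_mul_eq_mul_left (pow_pos hr.pos 1) this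
      refine ⟨(S : Subgroup (Abelianization G)).comap Abelianization.of,
        Subgroup.Normal.comap inferInstance _, ?_⟩
      have h1 := ((S : Subgroup (Abelianization G)).comap Abelianization.of).card_mul_index
      have hof : Function.Surjective (Abelianization.of (G := G)) :=
        QuotientGroup.mk'_surjective (commutator G)
      rw [Subgroup.index_comap_of_surjective _ hof, hSi, hc] at h1
      omega
    · exact ⟨_, inferInstance, h⟩
  have hKi : K.index = 3 := by
    have h1 := K.card_mul_index
    rw [hK, hc] at h1
    exact Nat.eq_of_mul_eq_mul_left (by omega : 0 < 4 * r) (by rw [h1]; ring)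
  obtain ⟨S⟩ : Nonempty (Sylow r K) := inferInstance
  have hS : Nat.card S = r ^ 1 := S.card_eq_of_card_eq_mul (m := 4) (by rw [hK]; ring) hr4
  have hSi : (S : Subgroup K).index = 4 := by
    have := (S : Subgroup K).card_mul_index
    rw [hS, hK] at this
    exact Nat.eq_of_mul_eq_mul_left (pow_pos hr.pos 1) (by rw [this]; ring)
  -- The number of Sylow `r`-subgroups of `K` is at most 4 and congruent to 1 modulo `r ≥ 5`. The
  -- unique one is characteristic in `K`, hence normal in `G`, with quotient of order 12.
  have hsub : Nat.card (Sylow r K) = 1 := by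
    have h1 : Nat.card (Sylow r K) ≤ 4 := Nat.le_of_dvd (by norm_num) (hSi ▸ S.card_dvd_index)
    have h2 := card_sylow_modEq_one r K
    rw [Nat.ModEq, Nat.mod_eq_of_lt (by omega), Nat.mod_eq_of_lt (by omega)] at h2
    exact h2
  have : Subsingleton (Sylow r K) := (Nat.card_eq_one_iff_unique.1 hsub).1
  let R : Subgroup G := (S : Subgroup K).map K.subtype
  have hRn : R.Normal := ConjAct.normal_of_characteristic_of_normal
  have hR : Nat.card R = r := by
    rw [Subgroup.card_map_of_injective K.subtype_injective, hS, pow_one]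
  have hB : Nat.card (G ⧸ R) = 12 := by
    have h1 : _ * Nat.card (G ⧸ R) = _ := R.card_mul_index
    rw [hR, hc, mul_comm 12] at h1
    exact Nat.eq_of_mul_eq_mul_left hr.pos h1
  have hVn : (K.map (QuotientGroup.mk' R)).Normal :=
    Subgroup.Normal.map hKn _ (QuotientGroup.mk'_surjective R)
  have hRK : R ≤ K := Subgroup.map_subtype_le _
  have hVi : (K.map (QuotientGroup.mk' R)).index = 3 := by
    rw [Subgroup.index_map_eq _ (QuotientGroup.mk'_surjective R) (by rwa [QuotientGroup.ker_mk']),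
      hKi]
  have hV : Nat.card (K.map (QuotientGroup.mk' R)) = 4 := by
    have h1 := (K.map (QuotientGroup.mk' R)).card_mul_index
    rw [hVi, hB] at h1
    omega
  let V : Sylow 2 (G ⧸ R) := Sylow.ofCard (K.map (QuotientGroup.mk' R)) (by
    obtain ⟨Q⟩ : Nonempty (Sylow 2 (G ⧸ R)) := inferInstance
    rw [hV, ← Q.card_eq_multiplicity, Q.card_eq_of_card_eq_mul (k := 2) (m := 3) (by rw [hB]; rfl)
      (by norm_num)]
    rfl)
  have hVn' : (V : Subgroup (G ⧸ R)).Normal := hVn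
  refine schurIsZMod_two_of_surjective P hP hcyc (QuotientGroup.mk' R)
    (QuotientGroup.mk'_surjective R) V hB ?_
  by_contra! hab
  have h1 := Subgroup.card_dvd_of_le (commutator_le_of_comm hab)
  rw [hR] at h1
  rcases h with h | h
  · rw [h, Nat.dvd_prime hr] at h1
    omega
  · rw [h] at h1
    have := Nat.le_of_dvd hr.pos h1
    omega

theorem schur_twelve_mul {r : ℕ} (hr : r.Prime) (h3r : 3 < r) (hc : Nat.card G = 12 * r)
    (h4 : Nat.card (commutator G) ≠ 4) (h4r : Nat.card (commutator G) ≠ 4 * r)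
    (hperf : commutator G ≠ ⊤) :
    (IsCyclic (Abelianization G) → SchurIsZero G) ∧
      (¬ IsCyclic (Abelianization G) → SchurIsZMod G 2) := by
  have : Fact r.Prime := ⟨hr⟩
  have h2r : ¬ 2 ∣ r := fun h => by have := (Nat.prime_dvd_prime_iff_eq Nat.prime_two hr).1 h; omega
  have hc' : Nat.card G = 2 ^ 2 * (3 * r) := by rw [hc]; ring
  obtain ⟨P⟩ : Nonempty (Sylow 2 G) := inferInstance
  have hP : Nat.card P = 2 ^ 2 :=
    P.card_eq_of_card_eq_mul hc' (Nat.prime_two.not_dvd_mul (by norm_num) h2r)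
  have h3rc : Nat.Coprime 3 r := (Nat.coprime_primes Nat.prime_three hr).2 h3r.ne
  have hcyc := Sylow.isCyclic_of_card_eq_sq_mul Nat.prime_two hc'
    ((Nat.squarefree_mul h3rc).2 ⟨Nat.prime_three.squarefree, hr.squarefree⟩)
  have hcomm := (IsPGroup.isMulCommutative_of_card_eq_prime_sq hP).is_comm.comm
  rcases P.normalizer_le_centralizer_or_of_card_sq hP (fun ℓ hℓ _ => hℓ.two_le) with
    hN | ⟨-, h3, -, g, hg, hfix⟩
  · exact schur_of_normalizer_le_centralizer P hP hN hcyc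
  exfalso
  have hPG : (P : Subgroup G) ≤ commutator G := le_commutator_of_fixedPointFree
    (fun x hx y hy => congrArg Subtype.val (hcomm ⟨x, hx⟩ ⟨y, hy⟩)) hg hfix
  -- The order is `4k` with `k ∣ 3r`, and the hypotheses exclude `k = 1`, `r` and `3r`.
  have h12 : Nat.card (commutator G) = 12 := by
    obtain ⟨k, hk⟩ : 2 ^ 2 ∣ Nat.card (commutator G) := hP ▸ Subgroup.card_dvd_of_le hPG
    have hd : k ∣ 3 * r := by
      refine Nat.dvd_of_mul_dvd_mul_left (by norm_num : 0 < 2 ^ 2) ?_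
      rw [← hk, ← hc']
      exact Subgroup.card_subgroup_dvd_card _
    obtain ⟨a, b, ha, hb, rfl⟩ := exists_dvd_and_dvd_of_dvd_mul hd
    rcases (Nat.dvd_prime Nat.prime_three).1 ha with rfl | rfl <;>
      rcases (Nat.dvd_prime hr).1 hb with rfl | rfl
    · omega
    · omega
    · omega
    · exact absurd (Subgroup.eq_top_of_card_eq _ (by rw [hk, hc'])) hperf
  have hi : (commutator G).index = r := by
    have h1 := (commutator G).card_mul_index
    rw [h12, hc] at h1
    omega
  -- By the Frattini argument the normalizer of `P` and the commutator subgroup generate `G`, so `r`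
  -- divides the order of the normalizer, as does 12.
  have hNT : Subgroup.normalizer (P : Set G) = ⊤ := by
    have hsup := P.normalizer_sup_eq_top' hPG
    have h1 : r ∣ Nat.card (Subgroup.normalizer (P : Set G)) := by
      have h2 := Subgroup.relIndex_sup_right (Subgroup.normalizer (P : Set G)) (commutator G)
      rw [hsup, Subgroup.relIndex_top_right, hi] at h2
      exact h2 ▸ Subgroup.relIndex_dvd_card _ _
    have hcop : Nat.Coprime 12 r := Nat.Coprime.mul_left
      (Nat.Coprime.pow_left 2 ((Nat.Prime.coprime_iff_not_dvd Nat.prime_two).2 h2r)) h3rc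
    refine Subgroup.eq_top_of_le_card _ (hc ▸ Nat.le_of_dvd Nat.card_pos ?_)
    exact hcop.mul_dvd_of_dvd_of_dvd (P.twelve_dvd_card_normalizer hP h3) h1
  have hn : (P : Subgroup G).Normal := Subgroup.normalizer_eq_top_iff.1 hNT
  have hmap : Nat.card ((commutator G).map (QuotientGroup.mk' (P : Subgroup G))) = 3 := by
    have h1 := ((commutator G).map (QuotientGroup.mk' (P : Subgroup G))).card_mul_index
    have h2 : _ * Nat.card (G ⧸ (P : Subgroup G)) = _ := (P : Subgroup G).card_mul_index
    rw [Subgroup.index_map_eq _ (QuotientGroup.mk'_surjective _)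
      (by rwa [QuotientGroup.ker_mk']), hi] at h1
    rw [hP, hc', ← h1] at h2
    exact Nat.eq_of_mul_eq_mul_right hr.pos (Nat.eq_of_mul_eq_mul_left (by norm_num) h2)
  have hcyc3 : IsCyclic ((commutator G).map (QuotientGroup.mk' (P : Subgroup G))) :=
    isCyclic_of_prime_card (p := 3) hmap
  -- In `G/P` the image of the commutator subgroup has order 3 and index `r > 3`, which forces `G/P`
  -- to be abelian, so 12 would divide 4.
  have hle := Subgroup.card_dvd_of_le (commutator_le_of_index_map_lt hr hPG hi
    (fun x hx y hy => congrArg Subtype.val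
      (IsCyclic.isMulCommutative.is_comm.comm
        (⟨x, hx⟩ : (commutator G).map (QuotientGroup.mk' (P : Subgroup G))) ⟨y, hy⟩))
    (by omega))
  rw [h12, hP] at hle
  exact absurd hle (by norm_num)

end

/-! ### Assembly of the five cases -/

theorem lemmad (G : Type) [Group G] [Finite G] (hG : ∃ a b : G, a * b ≠ b * a) :
    -- (i) square-free order
    (Squarefree (Nat.card G) → SchurIsZero G) ∧
    -- (ii) order p²q
    (∀ p q : ℕ, p.Prime → q.Prime → p < q → Nat.card G = p ^ 2 * q →
      -- one of the three listed cases occurs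
      ((IsoAdd (commutator G) (ZMod q) ∧ IsoAdd (Abelianization G) (ZMod (p ^ 2))) ∨
        (IsoAdd (commutator G) (ZMod q) ∧ IsoAdd (Abelianization G) (ZMod p × ZMod p)) ∨
        IsoAdd (commutator G) (ZMod 2 × ZMod 2)) ∧
      (IsoAdd (commutator G) (ZMod q) → IsoAdd (Abelianization G) (ZMod (p ^ 2)) →
        SchurIsZero G) ∧
      (IsoAdd (commutator G) (ZMod q) → IsoAdd (Abelianization G) (ZMod p × ZMod p) →
        SchurIsZMod G p) ∧
      (IsoAdd (commutator G) (ZMod 2 × ZMod 2) → SchurIsZMod G 2)) ∧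
    -- (iii) order pq²
    (∀ p q : ℕ, p.Prime → q.Prime → p < q → Nat.card G = p * q ^ 2 →
      -- one of the three listed cases occurs
      (IsoAdd (commutator G) (ZMod q) ∨ IsoAdd (commutator G) (ZMod (q ^ 2)) ∨
        IsoAdd (commutator G) (ZMod q × ZMod q)) ∧
      (IsoAdd (commutator G) (ZMod q) → SchurIsZero G) ∧
      (IsoAdd (commutator G) (ZMod (q ^ 2)) → SchurIsZero G) ∧
      (IsoAdd (commutator G) (ZMod q × ZMod q) → SchurIsZero G ∨ SchurIsZMod G q)) ∧
    -- (iv) order p²qr with pq ≠ 6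
    (∀ p q r : ℕ, p.Prime → q.Prime → r.Prime → p < q → q < r →
      Nat.card G = p ^ 2 * q * r → p * q ≠ 6 →
      (IsCyclic (Abelianization G) → SchurIsZero G) ∧
      (¬ IsCyclic (Abelianization G) → SchurIsZMod G p)) ∧
    -- (v) order p²qr with pq = 6; perfect groups are excluded from the first clause
    (∀ p q r : ℕ, p.Prime → q.Prime → r.Prime → p < q → q < r →
      Nat.card G = p ^ 2 * q * r → p * q = 6 →
      (Nat.card (commutator G) ≠ 4 → Nat.card (commutator G) ≠ 4 * r → commutator G ≠ ⊤ →
        (IsCyclic (Abelianization G) → SchurIsZero G) ∧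
        (¬ IsCyclic (Abelianization G) → SchurIsZMod G p)) ∧
      (Nat.card (commutator G) = 4 ∨ Nat.card (commutator G) = 4 * r → SchurIsZMod G 2)) := by
  refine ⟨fun h => ?_, fun p q hp hq hpq hc => schur_sq_mul_prime hG hp hq hpq hc,
    fun p q hp hq hpq hc => schur_prime_mul_sq hG hp hq hpq hc,
    fun p q r hp hq hr hpq hqr hc h6 => schur_sq_mul_mul p q r hp hq hr hpq hqr hc h6,
    fun p q r hp hq hr hpq hqr hc h6 => ?_⟩
  · have := IsZGroup.of_squarefree h
    exact schurIsZero_of_isZGroup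
  · obtain rfl : p = 2 := by
      have := hp.two_le
      by_contra hne
      nlinarith [show 3 ≤ p by omega]
    obtain rfl : q = 3 := by omega
    have hc' : Nat.card G = 12 * r := by rw [hc]; ring
    exact ⟨fun h4 h4r hperf => schur_twelve_mul hr hqr hc' h4 h4r hperf,
      fun h => schur_twelve_mul_of_card_commutator hr hqr hc' h⟩
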